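/- Let $L_{\mathrm{mt}}=\{<,\sqcap\}$, with $<$ a binary relation symbol and $\sqcap$ a binary function symbol. Let $\mathsf{DMT}$ be the $L_{\mathrm{mt}}$-theory of dense meet-trees, axiomatised by: $<$ is a strict partial order; any two elements lying below a common element are comparable; $x\sqcap y$ is the greatest common lower bound of $x$ and $y$; for every $a$, the set $\{x : x<a\}$ is a (nonempty) dense linear order without endpoints; and above every $a$ there are infinitely many open cones, i.e. classes of the equivalence relation $x\sqcap y>a$ on $\{x : x>a\}$. Write $x\parallel y$ if $x$ and $y$ are incomparable. A \emph{purely binary cone-expansion} of $\mathsf{DMT}$ is a complete theory $T\supseteq\mathsf{DMT}$ in a language $L=L_{\mathrm{mt}}\cup\{R_j : j\in J\}$, where $J$ is an arbitrary set and the $R_j$ are binary relation symbols, such that $T$ eliminates quantifiers in $L$ and, for every $j\in J$, $T$ proves that (a) $R_j(x,y)\rightarrow x\parallel y$, and (b) if $x\parallel y$, $x\sqcap x'>x\sqcap y$ and $y\sqcap y'>x\sqcap y$, then $R_j(x,y)\leftrightarrow R_j(x',y')$. Let $\kappa$ be an infinite cardinal and let $\mathfrak U$ be a $\kappa$-saturated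 model of $T$. For a language $L'$ and an $L'$-structure on $\mathfrak U$, a complete type $p(x)$ over $\mathfrak U$ in a finite tuple of variables $x$ is called \emph{invariant} if there is $A\subseteq\mathfrak U$ with $|A|<\kappa$ such that, for all $L'$-formulas $\phi(x;y)$ and all finite tuples $a,b$ from $\mathfrak U$ of the length of $y$ which have the same $L'$-type over $A$, we have $\phi(x;a)\in p$ if and only if $\phi(x;b)\in p$. If $p(x)$ is an invariant complete $L$-type over $\mathfrak U$ in finitely many variables, then its restriction $p\upharpoonright L_{\mathrm{mt}}$ to $L_{\mathrm{mt}}$-formulas over $\mathfrak U$ is an invariant complete type over the $L_{\mathrm{mt}}$-reduct $\mathfrak U\upharpoonright L_{\mathrm{mt}}$. -/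

import Mathlib

open FirstOrder FirstOrder.Language Cardinal

universe u v w u' v'

/-! ### Types over parameters, invariance, saturation, reducts -/

namespace InvType

section
variable (L : FirstOrder.Language.{u, v}) (M : Type w) [L.Structure M]

/-- `a ≡_A b` in `M`: the two tuples satisfy the same `L`-formulas with parameters in `A`. -/
def SameType (A : Set M) {m : ℕ} (a b : Fin m → M) : Prop :=
  ∀ φ : L[[A]].Formula (Fin m), φ.Realize a ↔ φ.Realize b

/-- `S_n(M)`: complete `n`-types over the whole structure `M`. -/
abbrev GlobalType (n : ℕ) : Type _ :=
  (L.elementaryDiagram M).CompleteType (Fin n)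

variable {L M}

/-- The formula `φ(x; a)` with parameters in `M`, obtained from an `L`-formula `φ(x; y)`
by substituting the tuple `a` for `y`. -/
def plug {n m : ℕ} (φ : L.Formula (Fin n ⊕ Fin m)) (a : Fin m → M) : L[[M]].Formula (Fin n) :=
  ((L.lhomWithConstants M).onFormula φ).subst
    (Sum.elim Term.var (fun i => (L.con (a i)).term))

/-- `p` is `A`-invariant: for all `φ(x; y)` in `L` and all `a ≡_A b` in `M`, the type `p` contains
`φ(x; a)` iff it contains `φ(x; b)`. -/
def IsInvariantOver {n : ℕ} (p : GlobalType L M n) (A : Set M) : Prop :=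
  ∀ (m : ℕ) (φ : L.Formula (Fin n ⊕ Fin m)) (a b : Fin m → M), SameType L M A a b →
    (Formula.equivSentence (plug φ a) ∈ p ↔ Formula.equivSentence (plug φ b) ∈ p)

/-- A global type is invariant (with respect to `κ`) if it is `A`-invariant for some `A ⊆ M` of
cardinality less than `κ`. -/
def IsInvariant {n : ℕ} (κ : Cardinal.{w}) (p : GlobalType L M n) : Prop :=
  ∃ A : Set M, #A < κ ∧ IsInvariantOver p A

variable (L M)

/-- `M` is `κ`-saturated: every complete `1`-type over a parameter set of cardinality less than `κ`
is realised in `M`. -/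
def IsSaturated [Nonempty M] (κ : Cardinal.{w}) : Prop :=
  ∀ A : Set M, #A < κ →
    ∀ p : (L[[A]].completeTheory M).CompleteType (Fin 1),
      p ∈ (L[[A]].completeTheory M).realizedTypes M (Fin 1)

end

section
variable {L : FirstOrder.Language.{u, v}} {L' : FirstOrder.Language.{u', v'}} {M : Type w}
  [L.Structure M] [L'.Structure M]

/-- The reduct of a global type along a map of languages `f : L → L'` (where the `L'`-structure on
`M` expands the `L`-structure): the set of all `L`-formulas over `M` whose image belongs to the
type. -/
def reductType (f : L →ᴸ L') [f.IsExpansionOn M] {n : ℕ} (p : GlobalType L' M n) :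
    GlobalType L M n where
  toTheory := {σ | ((f.addConstants M).addConstants (Fin n)).onSentence σ ∈ p}
  subset' := by
    rintro _ ⟨σ, hσ, rfl⟩
    have h : (L'[[M]].lhomWithConstants (Fin n)).onSentence ((f.addConstants M).onSentence σ) ∈ p := by
      apply p.subset
      refine ⟨_, ?_, rfl⟩
      rw [mem_completeTheory, LHom.realize_onSentence]
      exact hσ
    have e := (congrFun (LHom.comp_onBoundedFormula (α := Empty) (n := 0)
        (L'[[M]].lhomWithConstants (Fin n)) (f.addConstants M)) σ).symm.trans
      (congrFun (LHom.comp_onBoundedFormula (α := Empty) (n := 0)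
        ((f.addConstants M).addConstants (Fin n)) (L[[M]].lhomWithConstants (Fin n))) σ)
    exact (congrArg (· ∈ p) e).mp h
  isMaximal' := by
    refine ⟨?_, fun σ => p.mem_or_not_mem _⟩
    apply Theory.isSatisfiable_of_isSatisfiable_onTheory
      ((f.addConstants M).addConstants (Fin n))
    refine p.isMaximal.1.mono ?_
    rintro _ ⟨σ, hσ, rfl⟩
    exact hσ

end

end InvType

/-! ### Dense meet-trees and their purely binary cone-expansions -/

namespace MeetTree

/-- The function symbols of the language of meet-trees: one binary symbol `⊓`. -/
inductive MtFunctions : ℕ → Type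
  | meet : MtFunctions 2

/-- The relation symbols of the language of meet-trees: one binary symbol `<`. -/
inductive MtRelations : ℕ → Type
  | lt : MtRelations 2

/-- The language `L_mt = {<, ⊓}` of meet-trees. -/
def Lmt : FirstOrder.Language.{0, 0} := ⟨MtFunctions, MtRelations⟩

/-- Binary relation symbols `R_j`, indexed by `j : J`. -/
inductive ConeRelations (J : Type u) : ℕ → Type u
  | rel (j : J) : ConeRelations J 2

/-- The language consisting of the binary relation symbols `R_j`, `j : J`. -/
def Lrel (J : Type u) : FirstOrder.Language.{0, u} := ⟨fun _ => Empty, ConeRelations J⟩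

/-- The language `L = L_mt ∪ {R_j | j : J}`. -/
abbrev Lcone (J : Type u) : FirstOrder.Language.{0, u} := Lmt.sum (Lrel J)

/-- The symbol `⊓`. -/
abbrev meetSymb : Lmt.Functions 2 := MtFunctions.meet

/-- The symbol `<`. -/
abbrev ltSymb : Lmt.Relations 2 := MtRelations.lt

/-- The symbol `R_j`. -/
abbrev relSymb {J : Type u} (j : J) : (Lrel J).Relations 2 := ConeRelations.rel j

/-- The inclusion of `L_mt` in `L`. -/
abbrev incl (J : Type u) : Lmt →ᴸ Lcone J := LHom.sumInl

section
variable {n : ℕ}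

/-- The term `s ⊓ t`. -/
def meet (s t : Lmt.Term (Empty ⊕ Fin n)) : Lmt.Term (Empty ⊕ Fin n) :=
  Functions.apply₂ meetSymb s t

/-- The formula `s < t`. -/
def lt (s t : Lmt.Term (Empty ⊕ Fin n)) : Lmt.BoundedFormula Empty n :=
  Relations.boundedFormula₂ ltSymb s t

/-- The formula `s ≤ t`, that is, `s < t ∨ s = t`. -/
def le (s t : Lmt.Term (Empty ⊕ Fin n)) : Lmt.BoundedFormula Empty n :=
  lt s t ⊔ s.bdEqual t

/-- The formula `s ∥ t`: the elements `s` and `t` are incomparable. -/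
def par (s t : Lmt.Term (Empty ⊕ Fin n)) : Lmt.BoundedFormula Empty n :=
  ∼(le s t) ⊓ ∼(le t s)

end

/-- The axioms of dense meet-trees. In each axiom, `&0, &1, …` are the variables in the order in
which they are quantified; `.alls` quantifies universally over all remaining variables. -/
inductive DMTAxiom : Lmt.Sentence → Prop
  /-- `<` is irreflexive. -/
  | irrefl : DMTAxiom (∼(lt (n := 1) &0 &0)).alls
  /-- `<` is transitive. -/
  | trans : DMTAxiom (lt (n := 3) &0 &1 ⊓ lt &1 &2 ⟹ lt &0 &2).alls
  /-- Lower semilinearity: any two elements below a third one are comparable. -/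
  | semilinear : DMTAxiom (lt (n := 3) &0 &2 ⊓ lt &1 &2 ⟹ le &0 &1 ⊔ le &1 &0).alls
  /-- `x ⊓ y ≤ x`. -/
  | meet_left : DMTAxiom (le (n := 2) (meet &0 &1) &0).alls
  /-- `x ⊓ y ≤ y`. -/
  | meet_right : DMTAxiom (le (n := 2) (meet &0 &1) &1).alls
  /-- If `z ≤ x` and `z ≤ y`, then `z ≤ x ⊓ y`. -/
  | le_meet : DMTAxiom (le (n := 3) &2 &0 ⊓ le &2 &1 ⟹ le &2 (meet &0 &1)).alls
  /-- For `x < y` there is `z` with `x < z < y`. -/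
  | dense : DMTAxiom (lt (n := 2) &0 &1 ⟹ ∃' (lt &0 &2 ⊓ lt &2 &1)).alls
  /-- Every element has an element strictly below it. -/
  | no_min : DMTAxiom (∃' lt (n := 2) &1 &0).alls
  /-- There are infinitely many open cones above every `x₀`: for any finitely many
  `x₁, …, xₖ` there is `y > x₀` such that no `xᵢ` lies in the open cone of `y` above `x₀`,
  i.e. `x₀ < xᵢ ⊓ y` fails for all `i`. -/
  | cones (k : ℕ) : DMTAxiom
      (∃' (lt (n := k + 2) &0 &(Fin.last (k + 1)) ⊓
        BoundedFormula.iInf fun i : Fin k =>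
          ∼(lt &0 (meet &(i.succ.castSucc) &(Fin.last (k + 1)))))).alls

/-- The theory `DMT` of dense meet-trees. -/
def DMT : Lmt.Theory := {σ | DMTAxiom σ}

/-- The formula `R_j(s, t)`. -/
def R {J : Type u} (j : J) {n : ℕ} (s t : (Lcone J).Term (Empty ⊕ Fin n)) :
    (Lcone J).BoundedFormula Empty n :=
  Relations.boundedFormula₂ ((LHom.sumInr : Lrel J →ᴸ Lcone J).onRelation (relSymb j)) s t

/-- The sentence `∀ x y, R_j(x, y) → x ∥ y`. -/
def parAxiom {J : Type u} (j : J) : (Lcone J).Sentence :=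
  (R j (n := 2) &0 &1 ⟹ (incl J).onBoundedFormula (par &0 &1)).alls

/-- The sentence stating, for all `x, y, x', y'`, that if `x ∥ y`, `x ⊓ x' > x ⊓ y` and
`y ⊓ y' > x ⊓ y`, then `R_j(x, y) ↔ R_j(x', y')`. -/
def coneAxiom {J : Type u} (j : J) : (Lcone J).Sentence :=
  ((incl J).onBoundedFormula
      (par (n := 4) &0 &1 ⊓ lt (meet &0 &1) (meet &0 &2) ⊓ lt (meet &0 &1) (meet &1 &3)) ⟹
    (R j &0 &1 ⇔ R j &2 &3)).alls

/-- `T` eliminates quantifiers: every formula in finitely many free variables is equivalent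
modulo `T` to a quantifier-free formula in the same free variables. -/
def EliminatesQuantifiers {L : FirstOrder.Language.{u, v}} (T : L.Theory) : Prop :=
  ∀ (n : ℕ) (φ : L.Formula (Fin n)), ∃ ψ : L.Formula (Fin n), ψ.IsQF ∧ (φ ⇔[T] ψ)

/-- `T` is a purely binary cone-expansion of `DMT`, in the language `L_mt ∪ {R_j | j : J}`. -/
structure IsPurelyBinaryConeExpansion {J : Type u} (T : (Lcone J).Theory) : Prop where
  /-- `T` is complete. -/
  complete : T.IsComplete
  /-- `T` contains (entails) `DMT`. -/
  dmt : ∀ σ ∈ DMT, T ⊨ᵇ (incl J).onSentence σ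
  /-- `T` has quantifier elimination in `L`. -/
  qe : EliminatesQuantifiers T
  /-- Every `R_j` holds only between incomparable elements. -/
  par : ∀ j : J, T ⊨ᵇ parAxiom j
  /-- Every `R_j` depends only on the open cones above the meet of its arguments. -/
  cone : ∀ j : J, T ⊨ᵇ coneAxiom j

end MeetTree

/-! Realise the reduct of `p` by a tuple `c` in an elementary extension `N` of the meet-tree `U`,
and let `C` be the finite meet-subsemilattice generated by `c`. Finite partial isomorphisms between
dense meet-trees preserve all `L_mt`-formulas (`IsPartialIso.realize_iff`, by back and forth). So it
suffices to find a small `A'` such that tuples of `U` with the same `L_mt`-type over `A'` are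
matched by a finite partial isomorphism of `N` fixing `C` pointwise.

The difficulty is that `p` is only known to be invariant under equality of `L`-types, a finer
relation than equality of `L_mt`-types. What has to be controlled are the cuts of the elements `a`
of `U` below `u`, for `u` in `C`. Each cut is a downward closed chain, and belonging to it is a
condition on the `L`-type over `A` of one element. By quantifier elimination, and because the `R_j`
are binary and see only open cones, moving `b` to `b'` inside the same open cones over a meet-closed
set containing `A` keeps its `L`-type over `A` (`ConeEquivOver.sameType`). These moves are plentiful
enough to force each cut to be controlled by a small set (`exists_controlsCut`).

All other information about `C` over `U` needs only finitely many witnesses (`exists_determines`). A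
partial isomorphism of `U` fixing all these parameters then amalgamates with the identity of `C`
(`Determines.isPartialIso_amalgam`). -/

namespace InvType

/-! ### Substitution of parameters, reducts and realisation of types -/

section
variable {L : FirstOrder.Language.{u, v}} {L' : FirstOrder.Language.{u', v'}}

/-- Substitution, relabelling and the exchange of variables with constants are all instances of
`mapTermRel`, so this one induction reduces their compatibility with language maps to statements
about terms. -/
theorem onBoundedFormula_mapTermRel {L₁ L₁' : FirstOrder.Language} {α β : Type*}
    (g : L →ᴸ L') (g₁ : L₁ →ᴸ L₁')
    (ft : ∀ n, L.Term (α ⊕ Fin n) → L₁.Term (β ⊕ Fin n)) (fr : ∀ n, L.Relations n → L₁.Relations n)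
    (ft' : ∀ n, L'.Term (α ⊕ Fin n) → L₁'.Term (β ⊕ Fin n))
    (fr' : ∀ n, L'.Relations n → L₁'.Relations n)
    (hft : ∀ n t, g₁.onTerm (ft n t) = ft' n (g.onTerm t))
    (hfr : ∀ n R, g₁.onRelation (fr n R) = fr' n (g.onRelation R))
    {n : ℕ} (φ : L.BoundedFormula α n) :
    g₁.onBoundedFormula (φ.mapTermRel ft fr fun _ => id) =
      (g.onBoundedFormula φ).mapTermRel ft' fr' fun _ => id := by
  induction φ with
  | falsum => rfl
  | equal t₁ t₂ =>
    simp only [BoundedFormula.mapTermRel, LHom.onBoundedFormula, hft, Term.bdEqual]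
  | rel R ts =>
    simp only [BoundedFormula.mapTermRel, LHom.onBoundedFormula, Relations.boundedFormula, hfr,
      Function.comp_def, hft]
  | imp _ _ ih₁ ih₂ => simp only [BoundedFormula.mapTermRel, LHom.onBoundedFormula, ih₁, ih₂]
  | all _ ih => simp only [BoundedFormula.mapTermRel, LHom.onBoundedFormula, id, ih]

theorem onTerm_subst {α β : Type*} (g : L →ᴸ L') (t : L.Term α) (f : α → L.Term β) :
    g.onTerm (t.subst f) = (g.onTerm t).subst fun i => g.onTerm (f i) := by
  induction t with
  | var => rfl
  | func _ _ ih => simp only [Term.subst, LHom.onTerm, ih]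

theorem onTerm_relabel {α β : Type*} (g : L →ᴸ L') (t : L.Term α) (f : α → β) :
    g.onTerm (t.relabel f) = (g.onTerm t).relabel f := by
  induction t with
  | var => rfl
  | func _ _ ih => simp only [Term.relabel, LHom.onTerm, ih]

theorem onTerm_varsToConstants {α γ : Type*} (g : L →ᴸ L') (t : L.Term (γ ⊕ α)) :
    (g.addConstants γ).onTerm t.varsToConstants = (g.onTerm t).varsToConstants := by
  induction t with
  | var a =>
    cases a
    · simp only [Term.varsToConstants, LHom.onTerm, Constants.term]
      congr 1
      funext i
      exact i.elim0
    · rfl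
  | func _ _ ih =>
    simp only [Term.varsToConstants, LHom.onTerm, ih]
    rfl

theorem onFormula_subst {α β : Type*} (g : L →ᴸ L') (φ : L.Formula α) (f : α → L.Term β) :
    g.onFormula (BoundedFormula.subst φ f) =
      BoundedFormula.subst (g.onFormula φ) fun i => g.onTerm (f i) := by
  refine onBoundedFormula_mapTermRel g g _ _ _ _ (fun n t => ?_) (fun _ _ => rfl) φ
  rw [onTerm_subst]
  congr 1
  funext i
  cases i
  · exact onTerm_relabel _ _ _
  · rfl

theorem onSentence_equivSentence {α : Type*} (g : L →ᴸ L') (φ : L.Formula α) :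
    (g.addConstants α).onSentence (Formula.equivSentence φ) =
      Formula.equivSentence (g.onFormula φ) := by
  have h₁ : (g.addConstants α).onBoundedFormula (BoundedFormula.constantsVarsEquiv.symm
      ((BoundedFormula.relabelEquiv (Equiv.sumEmpty α Empty)).symm φ)) =
      BoundedFormula.constantsVarsEquiv.symm (g.onBoundedFormula
        ((BoundedFormula.relabelEquiv (Equiv.sumEmpty α Empty)).symm φ)) := by
    refine onBoundedFormula_mapTermRel g (g.addConstants α) _ _ _ _ (fun n t => ?_)
      (fun _ _ => rfl) _
    simp only [Term.constantsVarsEquivLeft_symm_apply, onTerm_varsToConstants, onTerm_relabel]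
  have h₂ : g.onBoundedFormula ((BoundedFormula.relabelEquiv (Equiv.sumEmpty α Empty)).symm φ) =
      (BoundedFormula.relabelEquiv (Equiv.sumEmpty α Empty)).symm (g.onBoundedFormula φ) :=
    onBoundedFormula_mapTermRel g g _ _ _ _ (fun n t => onTerm_relabel _ _ _) (fun _ _ => rfl) φ
  exact h₁.trans (congrArg _ h₂)

variable {M : Type w}

theorem onFormula_plug (g : L →ᴸ L') {n m : ℕ} (φ : L.Formula (Fin n ⊕ Fin m)) (a : Fin m → M) :
    (g.addConstants M).onFormula (plug φ a) = plug (g.onFormula φ) a := by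
  have e := (congrFun (LHom.comp_onBoundedFormula (α := Fin n ⊕ Fin m) (n := 0)
      (g.addConstants M) (L.lhomWithConstants M)) φ).symm.trans
    (congrFun (LHom.comp_onBoundedFormula (α := Fin n ⊕ Fin m) (n := 0)
      (L'.lhomWithConstants M) g) φ)
  refine (onFormula_subst _ _ _).trans ?_
  unfold plug
  congr 1
  funext i
  cases i
  · rfl
  · simp only [Sum.elim_inr, Constants.term, LHom.onTerm]
    congr 1
    funext i
    exact i.elim0

theorem mem_reductType_iff [L.Structure M] [L'.Structure M] (g : L →ᴸ L') [g.IsExpansionOn M]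
    {n m : ℕ} (p : GlobalType L' M n) (φ : L.Formula (Fin n ⊕ Fin m)) (a : Fin m → M) :
    Formula.equivSentence (plug φ a) ∈ reductType g p ↔
      Formula.equivSentence (plug (g.onFormula φ) a) ∈ p := by
  rw [← onFormula_plug, ← onSentence_equivSentence]
  rfl

/-- A global type is realised in an elementary extension. -/
theorem exists_elementaryEmbedding_realize [L.Structure M] [Nonempty M] {n : ℕ}
    (q : GlobalType L M n) :
    ∃ (N : Type (max u v w)) (_ : L.Structure N) (h : M ↪ₑ[L] N) (c : Fin n → N),
      ∀ (m : ℕ) (φ : L.Formula (Fin n ⊕ Fin m)) (a : Fin m → M),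
        Formula.equivSentence (plug φ a) ∈ q ↔ φ.Realize (Sum.elim c (h ∘ a)) := by
  obtain ⟨N, c, rfl⟩ := Theory.exists_modelType_is_realized_in _ q
  let _ : L.Structure N := (L.lhomWithConstants M).reduct N
  have : (L.lhomWithConstants M).IsExpansionOn N := LHom.isExpansionOn_reduct _ _
  refine ⟨N, inferInstance, ElementaryEmbedding.ofModelsElementaryDiagram L M N, c,
    fun m φ a => ?_⟩
  rw [Theory.CompleteType.formula_mem_typeOf, plug, Formula.Realize,
    BoundedFormula.realize_subst]
  refine ((L.lhomWithConstants M).realize_onBoundedFormula φ).trans (Eq.to_iff ?_)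
  unfold Formula.Realize
  congr 1
  funext i
  cases i
  · rfl
  · simp [Term.realize_constants, ElementaryEmbedding.ofModelsElementaryDiagram]
    rfl

end
end InvType

/-! ### Partial isomorphisms of dense meet-trees and one-point extensions -/

namespace MeetTree

/-- Dense meet-trees with infinitely many open cones above every point, as ordered sets. -/
structure IsDenseMeetTree (α : Type*) [SemilatticeInf α] : Prop where
  comparable : ∀ {x y z : α}, x ≤ z → y ≤ z → x ≤ y ∨ y ≤ x
  dense : ∀ {x y : α}, x < y → ∃ z, x < z ∧ z < y
  no_min : ∀ x : α, ∃ y, y < x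
  cones : ∀ (x : α) (s : Set α), s.Finite → ∃ y, x < y ∧ ∀ z ∈ s, ¬ x < z ⊓ y

/-- The graph of an isomorphism between two meet-subsemilattices. -/
structure IsPartialIso {α β : Type*} [SemilatticeInf α] [SemilatticeInf β]
    (E : Set (α × β)) : Prop where
  infClosed : InfClosed E
  le_iff : ∀ {x y x' y'}, (x, y) ∈ E → (x', y') ∈ E → (x ≤ x' ↔ y ≤ y')

section
variable {α β : Type*} [SemilatticeInf α] [SemilatticeInf β] {E : Set (α × β)}

theorem IsPartialIso.inf_mem (hE : IsPartialIso E) {x y x' y'} (h : (x, y) ∈ E)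
    (h' : (x', y') ∈ E) : (x ⊓ x', y ⊓ y') ∈ E := hE.infClosed h h'

theorem IsPartialIso.lt_iff (hE : IsPartialIso E) {x y x' y'} (h : (x, y) ∈ E)
    (h' : (x', y') ∈ E) : x < x' ↔ y < y' := by
  rw [lt_iff_le_not_ge, lt_iff_le_not_ge, hE.le_iff h h', hE.le_iff h' h]

theorem IsPartialIso.eq_iff (hE : IsPartialIso E) {x y x' y'} (h : (x, y) ∈ E)
    (h' : (x', y') ∈ E) : x = x' ↔ y = y' := by
  rw [le_antisymm_iff, le_antisymm_iff, hE.le_iff h h', hE.le_iff h' h]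

theorem IsPartialIso.swap (hE : IsPartialIso E) : IsPartialIso (Prod.swap ⁻¹' E) :=
  ⟨fun _ h _ h' => hE.inf_mem h h', fun h h' => (hE.le_iff h h').symm⟩

/-- A criterion for extending a partial isomorphism by one pair. -/
theorem IsPartialIso.insert (hE : IsPartialIso E) {d : α} {d' : β}
    (h : ∀ x y, (x, y) ∈ E → (d < x ∧ d' < y) ∨
      ((d ⊓ x, d' ⊓ y) ∈ E ∧ ¬ d ≤ x ∧ ¬ d' ≤ y)) : IsPartialIso (insert (d, d') E) := by
  have key : ∀ x y, (x, y) ∈ E →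
      (d ⊓ x, d' ⊓ y) ∈ Insert.insert (d, d') E ∧ (x ≤ d ↔ y ≤ d') ∧ (d ≤ x ↔ d' ≤ y) := by
    intro x y hxy
    rcases h x y hxy with ⟨h₁, h₂⟩ | ⟨h₁, h₂, h₃⟩
    · refine ⟨Or.inl ?_, ?_, iff_of_true h₁.le h₂.le⟩
      · rw [inf_eq_left.2 h₁.le, inf_eq_left.2 h₂.le]
      · exact iff_of_false h₁.not_ge h₂.not_ge
    · refine ⟨Or.inr h₁, ?_, iff_of_false h₂ h₃⟩
      rw [← inf_eq_right, ← inf_eq_right]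
      exact hE.eq_iff h₁ hxy
  refine ⟨?_, ?_⟩
  · rintro ⟨x, y⟩ (h₁ | h₁) ⟨x', y'⟩ (h₂ | h₂)
    · cases h₁; cases h₂
      left
      simp
    · cases h₁
      exact (key _ _ h₂).1
    · cases h₂
      have := (key _ _ h₁).1
      rwa [inf_comm d, inf_comm d'] at this
    · exact Or.inr (hE.infClosed h₁ h₂)
  · rintro x y x' y' (h₁ | h₁) (h₂ | h₂)
    · cases h₁; cases h₂; simp
    · cases h₁
      exact (key _ _ h₂).2.2
    · cases h₂
      exact (key _ _ h₁).2.1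
    · exact hE.le_iff h₁ h₂

/-- Elements below `b` form a chain, so a nonempty `S` has a greatest element and density applies;
the empty case uses `no_min`. -/
theorem IsDenseMeetTree.exists_between (hβ : IsDenseMeetTree β) {S : Set β} (hS : S.Finite) {b : β}
    (h : ∀ y ∈ S, y < b) : ∃ z, z < b ∧ ∀ y ∈ S, y < z := by
  rcases S.eq_empty_or_nonempty with rfl | hne
  · obtain ⟨z, hz⟩ := hβ.no_min b
    exact ⟨z, hz, by simp⟩
  · obtain ⟨m, hm⟩ := hS.exists_maximal hne
    obtain ⟨z, hmz, hzb⟩ := hβ.dense (h m hm.prop)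
    refine ⟨z, hzb, fun y hy => lt_of_le_of_lt ?_ hmz⟩
    rcases hβ.comparable (h y hy).le (h m hm.prop).le with h' | h'
    · exact h'
    · exact hm.le_of_ge hy h'

/-- One-point extension by a point below some point of the domain. -/
theorem IsPartialIso.exists_extension_of_le (hα : IsDenseMeetTree α) (hβ : IsDenseMeetTree β)
    (hE : IsPartialIso E) (hfin : E.Finite) {e : α} (he : ∃ p ∈ E, e ≤ p.1) :
    ∃ e', IsPartialIso (Insert.insert (e, e') E) := by
  by_cases hdom : ∃ e', (e, e') ∈ E
  · obtain ⟨e', h⟩ := hdom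
    exact ⟨e', by rwa [Set.insert_eq_of_mem h]⟩
  -- The domain is meet-closed, so a minimal domain point above `e` is the least one; `e'` is placed
  -- under its image and over the images of all domain points below `e`.
  obtain ⟨⟨x₀, y₀⟩, hmin⟩ := (hfin.subset (Set.sep_subset E fun p => e ≤ p.1)).exists_minimal he
  have h₀ : (x₀, y₀) ∈ E := hmin.prop.1
  have hx₀ : e ≤ x₀ := hmin.prop.2
  have hne : ∀ {x y}, (x, y) ∈ E → e ≤ x → e < x := fun h h' =>
    lt_of_le_of_ne h' fun he => hdom ⟨_, he ▸ h⟩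
  have hleast : ∀ {x y}, (x, y) ∈ E → e ≤ x → x₀ ≤ x := by
    intro x y h hx
    have := hmin.le_of_le ⟨hE.inf_mem h h₀, le_inf hx hx₀⟩
      ⟨inf_le_right, inf_le_right⟩
    exact this.1.trans inf_le_left
  obtain ⟨e', he'₀, he'⟩ := hβ.exists_between (S := Prod.snd '' {p ∈ E | p.1 < e})
    ((hfin.subset (Set.sep_subset _ _)).image _) (b := y₀) (by
      rintro _ ⟨⟨x, y⟩, ⟨h, hx⟩, rfl⟩
      exact (hE.lt_iff h h₀).1 (lt_of_lt_of_le hx hx₀))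
  refine ⟨e', hE.insert fun x y h => ?_⟩
  by_cases hx : e ≤ x
  · exact Or.inl ⟨hne h hx, lt_of_lt_of_le he'₀ ((hE.le_iff h₀ h).1 (hleast h hx))⟩
  · have hlt : x ⊓ x₀ < e := by
      rcases hα.comparable (inf_le_right : x ⊓ x₀ ≤ x₀) hx₀ with h' | h'
      · exact lt_of_le_not_ge h' fun h'' => hx (h''.trans inf_le_left)
      · exact absurd (h'.trans inf_le_left) hx
    have hlt' : y ⊓ y₀ < e' := he' _ ⟨(x ⊓ x₀, y ⊓ y₀), ⟨hE.inf_mem h h₀, hlt⟩, rfl⟩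
    refine Or.inr ⟨?_, hx, fun hy => ?_⟩
    · have h₁ : e ⊓ x = x ⊓ x₀ := le_antisymm (le_inf inf_le_right (inf_le_left.trans hx₀))
        (le_inf hlt.le inf_le_left)
      have h₂ : e' ⊓ y = y ⊓ y₀ := le_antisymm (le_inf inf_le_right (inf_le_left.trans he'₀.le))
        (le_inf hlt'.le inf_le_left)
      rw [h₁, h₂]
      exact hE.inf_mem h h₀
    · exact hlt'.not_ge (le_inf hy he'₀.le)

/-- One-point extension: the forth property of finite partial isomorphisms. -/
theorem IsPartialIso.exists_extension [Nonempty β] (hα : IsDenseMeetTree α)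
    (hβ : IsDenseMeetTree β) (hE : IsPartialIso E) (hfin : E.Finite) (d : α) :
    ∃ E', IsPartialIso E' ∧ E'.Finite ∧ E ⊆ E' ∧ ∃ d', (d, d') ∈ E' := by
  by_cases hd : ∃ p ∈ E, d ≤ p.1
  · obtain ⟨d', h⟩ := hE.exists_extension_of_le hα hβ hfin hd
    exact ⟨_, h, hfin.insert _, Set.subset_insert _ _, d', Set.mem_insert _ _⟩
  rcases E.eq_empty_or_nonempty with rfl | hne
  · obtain ⟨d'⟩ := ‹Nonempty β›
    exact ⟨_, hE.insert (d := d) (d' := d') (by simp), Set.finite_empty.insert _,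
      Set.subset_insert _ _, d', Set.mem_insert _ _⟩
  -- `p₀` is the point where `d` branches off from the domain. It is added first; the image of `d`
  -- is then taken in an open cone above `e'` that avoids the range.
  obtain ⟨p₀, hmax⟩ := (hfin.image fun p => d ⊓ p.1).exists_maximal (hne.image _)
  obtain ⟨⟨x₁, y₁⟩, h₁, hp₀⟩ := hmax.prop
  simp only at hp₀
  have hmax' : ∀ {x y}, (x, y) ∈ E → d ⊓ x ≤ p₀ := by
    intro x y h
    have hle : p₀ ≤ d := hp₀ ▸ inf_le_left
    rcases hα.comparable (inf_le_left : d ⊓ x ≤ d) hle with h' | h'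
    · exact h'
    · exact hmax.le_of_ge ⟨(x, y), h, rfl⟩ h'
  obtain ⟨e', hE₁⟩ := hE.exists_extension_of_le (e := p₀) hα hβ hfin ⟨_, h₁, hp₀ ▸ inf_le_right⟩
  have hfin₁ := hfin.insert (p₀, e')
  set E₁ := Insert.insert (p₀, e') E with hE₁_def
  have hmem : (p₀, e') ∈ E₁ := Set.mem_insert _ _
  have hp₀d : p₀ < d := lt_of_le_of_ne (hp₀ ▸ inf_le_left) fun h => hd ⟨_, h₁, by
    rw [← h, ← hp₀]; exact inf_le_right⟩
  have hmax₁ : ∀ {x y}, (x, y) ∈ E₁ → d ⊓ x ≤ p₀ := by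
    rintro x y (h | h)
    · cases h; exact inf_le_right
    · exact hmax' h
  obtain ⟨d', hd', hcone⟩ := hβ.cones e' (Prod.snd '' E₁) (hfin₁.image _)
  refine ⟨_, hE₁.insert (d := d) (d' := d') fun x y h => Or.inr ?_, hfin₁.insert _,
    (Set.subset_insert _ _).trans (Set.subset_insert _ _), d', Set.mem_insert _ _⟩
  have hy : d' ⊓ y ≤ e' := by
    have := hcone y ⟨_, h, rfl⟩
    rw [inf_comm] at this
    rcases hβ.comparable (inf_le_left : d' ⊓ y ≤ d') hd'.le with h' | h'
    · exact h'
    · exact (eq_of_le_of_not_lt h' this).ge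
  have hx := hmax₁ h
  have e₁ : d ⊓ x = p₀ ⊓ x := le_antisymm (le_inf hx inf_le_right)
    (inf_le_inf_right _ hp₀d.le)
  have e₂ : d' ⊓ y = e' ⊓ y := le_antisymm (le_inf hy inf_le_right)
    (inf_le_inf_right _ hd'.le)
  refine ⟨?_, fun hdx => ?_, fun hdy => ?_⟩
  · rw [e₁, e₂]
    exact hE₁.inf_mem hmem h
  · exact hp₀d.not_ge ((le_inf le_rfl hdx).trans hx)
  · exact hd'.not_ge ((le_inf le_rfl hdy).trans hy)

end
end MeetTree

/-! ### From models of `DMT` to ordered sets, and preservation of formulas -/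

namespace MeetTree

/-- The symbols of `L_mt` are interpreted as the strict order and the meet of `α`. -/
class CompatibleOrder (α : Type*) [Lmt.Structure α] [SemilatticeInf α] : Prop where
  relMap_lt : ∀ a b : α, Structure.RelMap ltSymb ![a, b] ↔ a < b
  funMap_meet : ∀ a b : α, Structure.funMap meetSymb ![a, b] = a ⊓ b

section
variable {α : Type*} [Lmt.Structure α]

theorem realize_lt {n : ℕ} (s t : Lmt.Term (Empty ⊕ Fin n)) (v : Empty → α) (xs : Fin n → α) :
    (lt s t).Realize v xs ↔ Structure.RelMap ltSymb
      ![s.realize (Sum.elim v xs), t.realize (Sum.elim v xs)] :=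
  BoundedFormula.realize_rel₂

theorem realize_meet {n : ℕ} (s t : Lmt.Term (Empty ⊕ Fin n)) (v : Empty ⊕ Fin n → α) :
    (meet s t).realize v = Structure.funMap meetSymb ![s.realize v, t.realize v] :=
  Term.realize_functions_apply₂

theorem realize_le {n : ℕ} (s t : Lmt.Term (Empty ⊕ Fin n)) (v : Empty → α) (xs : Fin n → α) :
    (le s t).Realize v xs ↔ (Structure.RelMap ltSymb
      ![s.realize (Sum.elim v xs), t.realize (Sum.elim v xs)] ∨
      s.realize (Sum.elim v xs) = t.realize (Sum.elim v xs)) := by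
  rw [le, BoundedFormula.realize_sup, realize_lt, BoundedFormula.realize_bdEqual]

theorem exists_semilatticeInf (h : α ⊨ DMT) :
    ∃ _ : SemilatticeInf α, CompatibleOrder α ∧ IsDenseMeetTree α := by
  have ax : ∀ {σ : Lmt.Sentence}, DMTAxiom σ → α ⊨ σ := fun hσ => h.realize_of_mem _ hσ
  set r : α → α → Prop := fun a b => Structure.RelMap ltSymb ![a, b] with hr
  set m : α → α → α := fun a b => Structure.funMap meetSymb ![a, b] with hm
  have irrefl : ∀ a, ¬ r a a := fun a => by
    have := BoundedFormula.realize_alls.1 (ax .irrefl) ![a]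
    simpa [realize_lt] using this
  have trans : ∀ a b c, r a b → r b c → r a c := fun a b c h₁ h₂ => by
    have := BoundedFormula.realize_alls.1 (ax .trans) ![a, b, c]
    simp only [BoundedFormula.realize_imp, BoundedFormula.realize_inf, realize_lt] at this
    exact this ⟨h₁, h₂⟩
  have semilinear : ∀ a b c, r a c → r b c → (r a b ∨ a = b) ∨ (r b a ∨ b = a) :=
    fun a b c h₁ h₂ => by
    have := BoundedFormula.realize_alls.1 (ax .semilinear) ![a, b, c]
    simp only [BoundedFormula.realize_imp, BoundedFormula.realize_inf, realize_lt, realize_le,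
      BoundedFormula.realize_sup] at this
    exact this ⟨h₁, h₂⟩
  have meet_left : ∀ a b, r (m a b) a ∨ m a b = a := fun a b => by
    have := BoundedFormula.realize_alls.1 (ax .meet_left) ![a, b]
    simp only [realize_le, realize_meet] at this
    exact this
  have meet_right : ∀ a b, r (m a b) b ∨ m a b = b := fun a b => by
    have := BoundedFormula.realize_alls.1 (ax .meet_right) ![a, b]
    simp only [realize_le, realize_meet] at this
    exact this
  have le_meet : ∀ a b c, (r a b ∨ a = b) → (r a c ∨ a = c) → (r a (m b c) ∨ a = m b c) :=
    fun a b c h₁ h₂ => by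
    have := BoundedFormula.realize_alls.1 (ax .le_meet) ![b, c, a]
    simp only [BoundedFormula.realize_imp, BoundedFormula.realize_inf, realize_le,
      realize_meet] at this
    exact this ⟨h₁, h₂⟩
  have dense : ∀ a b, r a b → ∃ c, r a c ∧ r c b := fun a b h₁ => by
    have := BoundedFormula.realize_alls.1 (ax .dense) ![a, b]
    simp only [BoundedFormula.realize_imp, BoundedFormula.realize_inf, realize_lt,
      BoundedFormula.realize_ex] at this
    exact this h₁
  have no_min : ∀ a, ∃ b, r b a := fun a => by
    have := BoundedFormula.realize_alls.1 (ax .no_min) ![a]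
    simp only [realize_lt, BoundedFormula.realize_ex] at this
    exact this
  have cones : ∀ (a : α) (k : ℕ) (z : Fin k → α), ∃ b, r a b ∧ ∀ i, ¬ r a (m (z i) b) :=
    fun a k z => by
    have := BoundedFormula.realize_alls.1 (ax (.cones k)) (Fin.cons a z)
    simp only [BoundedFormula.realize_ex, BoundedFormula.realize_inf, realize_lt,
      BoundedFormula.realize_iInf, BoundedFormula.realize_not, realize_meet] at this
    obtain ⟨b, h₁, h₂⟩ := this
    refine ⟨b, ?_, fun i => ?_⟩
    · convert h₁ using 3
      · rfl
      · exact (Fin.snoc_last (α := fun _ => α) _ _).symm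
    · convert h₂ i using 4
      · rfl
      · exact (Fin.snoc_castSucc (α := fun _ => α) b (Fin.cons a z : Fin (k + 1) → α) i.succ).symm
      · exact (Fin.snoc_last (α := fun _ => α) _ _).symm
  let I : SemilatticeInf α :=
    { le := fun a b => r a b ∨ a = b
      lt := r
      le_refl := fun a => Or.inr rfl
      le_trans := by
        rintro a b c (h₁ | rfl) (h₂ | rfl)
        · exact Or.inl (trans _ _ _ h₁ h₂)
        · exact Or.inl h₁
        · exact Or.inl h₂
        · exact Or.inr rfl
      le_antisymm := by
        rintro a b (h₁ | rfl) (h₂ | h₂)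
        · exact absurd (trans _ _ _ h₁ h₂) (irrefl _)
        · exact h₂.symm
        · rfl
        · rfl
      lt_iff_le_not_ge := by
        intro a b
        constructor
        · intro h₁
          refine ⟨Or.inl h₁, ?_⟩
          rintro (h₂ | rfl)
          · exact irrefl _ (trans _ _ _ h₁ h₂)
          · exact irrefl _ h₁
        · rintro ⟨h₁ | rfl, h₂⟩
          · exact h₁
          · exact absurd (Or.inr rfl) h₂
      inf := m
      inf_le_left := meet_left
      inf_le_right := meet_right
      le_inf := le_meet }
  refine ⟨I, ⟨fun _ _ => Iff.rfl, fun _ _ => rfl⟩, ⟨?_, fun {a b} => dense a b, no_min, ?_⟩⟩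
  · rintro a b c (h₁ | rfl) (h₂ | rfl)
    · exact semilinear a b c h₁ h₂
    · exact Or.inl (Or.inl h₁)
    · exact Or.inr (Or.inl h₂)
    · exact Or.inl (Or.inr rfl)
  · intro a s hs
    obtain ⟨k, z, -, rfl⟩ := hs.fin_param
    obtain ⟨b, h₁, h₂⟩ := cones a k z
    exact ⟨b, h₁, by rintro _ ⟨i, rfl⟩; exact h₂ i⟩

variable [SemilatticeInf α] [CompatibleOrder α]

theorem funMap_meetSymb (x : Fin 2 → α) : Structure.funMap meetSymb x = x 0 ⊓ x 1 := by
  rw [← CompatibleOrder.funMap_meet]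
  congr 1
  exact List.ofFn_inj.1 rfl

theorem relMap_ltSymb (x : Fin 2 → α) : Structure.RelMap ltSymb x ↔ x 0 < x 1 := by
  rw [← CompatibleOrder.relMap_lt]
  apply Eq.to_iff
  congr 1
  exact List.ofFn_inj.1 rfl

end

section
variable {L : FirstOrder.Language.{u, v}} {α β : Type*} [L.Structure α] [L.Structure β]

/-- A relation closed under the functions and compatible with equality and the relations of `L`. -/
structure IsAtomicRelation (L : FirstOrder.Language.{u, v}) {α β : Type*} [L.Structure α]
    [L.Structure β] (E : Set (α × β)) : Prop where
  funMap_mem : ∀ {k} (f : L.Functions k) (x : Fin k → α) (y : Fin k → β),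
    (∀ i, (x i, y i) ∈ E) → (Structure.funMap f x, Structure.funMap f y) ∈ E
  relMap_iff : ∀ {k} (r : L.Relations k) (x : Fin k → α) (y : Fin k → β),
    (∀ i, (x i, y i) ∈ E) → (Structure.RelMap r x ↔ Structure.RelMap r y)
  eq_iff : ∀ {x y x' y'}, (x, y) ∈ E → (x', y') ∈ E → (x = x' ↔ y = y')

theorem IsAtomicRelation.term_mem {E : Set (α × β)} (hE : IsAtomicRelation L E) {ι : Type*}
    {x : ι → α} {y : ι → β} (h : ∀ i, (x i, y i) ∈ E) (t : L.Term ι) :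
    (t.realize x, t.realize y) ∈ E := by
  induction t with
  | var i => exact h i
  | func f ts ih => exact hE.funMap_mem f _ _ ih

theorem IsAtomicRelation.realize_atomic {E : Set (α × β)} (hE : IsAtomicRelation L E) {ι : Type*}
    {k : ℕ} {φ : L.BoundedFormula ι k} (hφ : φ.IsAtomic) {x : ι → α} {y : ι → β}
    {xs : Fin k → α} {ys : Fin k → β} (h : ∀ i, (x i, y i) ∈ E) (hs : ∀ i, (xs i, ys i) ∈ E) :
    φ.Realize x xs ↔ φ.Realize y ys := by
  have h' : ∀ i, (Sum.elim x xs i, Sum.elim y ys i) ∈ E := by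
    rintro (i | i)
    · exact h i
    · exact hs i
  cases hφ with
  | equal t₁ t₂ =>
    rw [BoundedFormula.realize_bdEqual, BoundedFormula.realize_bdEqual]
    exact hE.eq_iff (hE.term_mem h' t₁) (hE.term_mem h' t₂)
  | rel r ts =>
    rw [BoundedFormula.realize_rel, BoundedFormula.realize_rel]
    exact hE.relMap_iff _ _ _ fun i => hE.term_mem h' (ts i)

theorem IsAtomicRelation.realize_qf {E : Set (α × β)} (hE : IsAtomicRelation L E) {ι : Type*}
    {k : ℕ} {φ : L.BoundedFormula ι k} (hφ : φ.IsQF) {x : ι → α} {y : ι → β}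
    {xs : Fin k → α} {ys : Fin k → β} (h : ∀ i, (x i, y i) ∈ E) (hs : ∀ i, (xs i, ys i) ∈ E) :
    φ.Realize x xs ↔ φ.Realize y ys := by
  induction hφ with
  | falsum => rfl
  | of_isAtomic hφ => exact hE.realize_atomic hφ h hs
  | imp _ _ ih₁ ih₂ =>
    rw [BoundedFormula.realize_imp, BoundedFormula.realize_imp, ih₁, ih₂]

/-- Modulo a theory with quantifier elimination, atomic relations preserve all formulas. -/
theorem IsAtomicRelation.realize_iff_of_eliminatesQuantifiers [Nonempty α] [Nonempty β]
    {T : L.Theory} (hT : EliminatesQuantifiers T) (hα : α ⊨ T) (hβ : β ⊨ T)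
    {E : Set (α × β)} (hE : IsAtomicRelation L E) {ι : Type*} (φ : L.Formula ι)
    {x : ι → α} {y : ι → β} (h : ∀ i, (x i, y i) ∈ E) : φ.Realize x ↔ φ.Realize y := by
  classical
  -- `ι` may be infinite, whereas quantifier elimination concerns finitely many variables; only the
  -- variables occurring in `φ` are kept.
  let e := φ.freeVarFinset.equivFin
  obtain ⟨ψ, hψ, hφψ⟩ := hT _ (BoundedFormula.restrictFreeVar φ e)
  have key (z : ι → α) : (BoundedFormula.restrictFreeVar φ e).Realize
      (fun i => z (e.symm i)) default ↔ φ.Realize z :=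
    BoundedFormula.realize_restrictFreeVar z (by simp)
  have key' (z : ι → β) : (BoundedFormula.restrictFreeVar φ e).Realize
      (fun i => z (e.symm i)) default ↔ φ.Realize z :=
    BoundedFormula.realize_restrictFreeVar z (by simp)
  rw [← key x, ← key' y]
  have h₁ := hφψ.realize_iff (M := α) (v := fun i => x (e.symm i))
  have h₂ := hφψ.realize_iff (M := β) (v := fun i => y (e.symm i))
  exact h₁.trans ((hE.realize_qf hψ (fun i => h _) (fun i => i.elim0)).trans h₂.symm)

end

section
variable {α β : Type*} [Lmt.Structure α] [SemilatticeInf α] [CompatibleOrder α]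
  [Lmt.Structure β] [SemilatticeInf β] [CompatibleOrder β] {E : Set (α × β)}

theorem IsPartialIso.isAtomicRelation (hE : IsPartialIso E) : IsAtomicRelation Lmt E where
  funMap_mem := by
    rintro _ ⟨⟩ x y h
    have h₁ := funMap_meetSymb x
    have h₂ := funMap_meetSymb y
    rw [h₁, h₂]
    exact hE.inf_mem (h 0) (h 1)
  relMap_iff := by
    rintro _ ⟨⟩ x y h
    exact (relMap_ltSymb x).trans ((hE.lt_iff (h 0) (h 1)).trans (relMap_ltSymb y).symm)
  eq_iff := hE.eq_iff

/-- Finite partial isomorphisms between dense meet-trees preserve all formulas. -/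
theorem IsPartialIso.realize_iff [Nonempty α] [Nonempty β] (hα : IsDenseMeetTree α)
    (hβ : IsDenseMeetTree β) {ι : Type*} {k : ℕ} (φ : Lmt.BoundedFormula ι k)
    {E : Set (α × β)} (hE : IsPartialIso E) (hfin : E.Finite) {x : ι → α} {y : ι → β}
    {xs : Fin k → α} {ys : Fin k → β} (h : ∀ i, (x i, y i) ∈ E) (hs : ∀ i, (xs i, ys i) ∈ E) :
    φ.Realize x xs ↔ φ.Realize y ys := by
  induction φ generalizing E with
  | falsum => rfl
  | equal t₁ t₂ => exact hE.isAtomicRelation.realize_atomic (.equal t₁ t₂) h hs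
  | rel r ts => exact hE.isAtomicRelation.realize_atomic (.rel r ts) h hs
  | imp _ _ ih₁ ih₂ =>
    rw [BoundedFormula.realize_imp, BoundedFormula.realize_imp, ih₁ hE hfin h hs,
      ih₂ hE hfin h hs]
  | @all n φ ih =>
    rw [BoundedFormula.realize_all, BoundedFormula.realize_all]
    have snoc_mem : ∀ {E' : Set (α × β)}, E ⊆ E' → ∀ {d d'}, (d, d') ∈ E' →
        ∀ i : Fin (n + 1), ((Fin.snoc xs d : Fin (n + 1) → α) i,
          (Fin.snoc ys d' : Fin (n + 1) → β) i) ∈ E' := by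
      intro E' hsub d d' hd i
      refine Fin.lastCases ?_ (fun i => ?_) i
      · simpa using hd
      · simpa using hsub (hs i)
    constructor
    · intro H d'
      obtain ⟨E', hE', hfin', hsub, d, hd⟩ :=
        hE.swap.exists_extension hβ hα (hfin.preimage Prod.swap_injective.injOn) d'
      refine (ih hE'.swap (hfin'.preimage Prod.swap_injective.injOn) (fun i => hsub (h i))
        (snoc_mem (fun p hp => hsub (a := p.swap) (by simpa using hp)) hd)).1 (H d)
    · intro H d
      obtain ⟨E', hE', hfin', hsub, d', hd⟩ := hE.exists_extension hα hβ hfin d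
      exact (ih hE' hfin' (fun i => hsub (h i)) (snoc_mem hsub hd)).2 (H d')

end
end MeetTree

/-! ### Small control of invariant cuts -/

namespace MeetTree

section
variable {U : Type w} [SemilatticeInf U]

/-- The lower chain `B` has a cofinal subset in `A`, or a proper upper bound `c` in `A` below which
its complement has a coinitial subset in `A`. -/
def ControlsCut (A B : Set U) : Prop :=
  (∀ b ∈ B, ∃ c ∈ A, c ∈ B ∧ b ≤ c) ∨
    ∃ c ∈ A, (∀ b ∈ B, b ≤ c) ∧ ∀ d ≤ c, d ∉ B → ∃ e ∈ A, e ∉ B ∧ e ≤ d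

theorem ControlsCut.mono {A A' B : Set U} (h : ControlsCut A B) (hA : A ⊆ A') :
    ControlsCut A' B := by
  rcases h with h | ⟨c, hc, h₁, h₂⟩
  · exact Or.inl fun b hb => let ⟨c, hc, h'⟩ := h b hb; ⟨c, hA hc, h'⟩
  · exact Or.inr ⟨c, hA hc, h₁, fun d hd hd' => let ⟨e, he, h'⟩ := h₂ d hd hd'; ⟨e, hA he, h'⟩⟩

/-- Translating `b` to `b'` and fixing `D` pointwise preserves the meet-tree structure and the open
cones of the points of `D`. -/
def ConeEquivOver (D : Set U) (b b' : U) : Prop :=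
  ∀ a ∈ D, (b < a ∧ b' < a) ∨ (b ⊓ a = b' ⊓ a ∧ b ⊓ a ∈ D ∧ b ⊓ a < b ⊓ b')

/-- If neither side of the cut is approached by parameters derived from `A`, there is room to move a
point of `B` out of `B` without changing its open cones over a meet-closed set containing `A`,
against `hinv`. -/
theorem exists_controlsCut (hU : IsDenseMeetTree U) {κ : Cardinal.{w}} (hκ : ℵ₀ ≤ κ) {A B : Set U}
    (hA : #A < κ) (hlow : IsLowerSet B) (hchain : ∀ x ∈ B, ∀ y ∈ B, x ≤ y ∨ y ≤ x)
    (hinv : ∀ D, InfClosed D → A ⊆ D → ∀ b b', ConeEquivOver D b b' → (b ∈ B ↔ b' ∈ B)) :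
    ∃ A' : Set U, #A' < κ ∧ ControlsCut A' B := by
  classical
  have hsmall : ∀ x : U, #({x} : Set U) < κ := fun x =>
    (mk_singleton x).trans_lt (one_lt_aleph0.trans_le hκ)
  -- `g a` is a witness that `a` does not bound `B`. If these witnesses are not cofinal, some `b₀`
  -- in `B` is beyond all of them, and then every `a` in `A` above `b₀` bounds `B`.
  have hg : ∀ a : A, ∃ g : U, (∃ b ∈ B, ¬ b ≤ a) → g ∈ B ∧ ¬ g ≤ a := fun a => by
    by_cases h : ∃ b ∈ B, ¬ b ≤ (a : U)
    · obtain ⟨b, hb⟩ := h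
      exact ⟨b, fun _ => hb⟩
    · exact ⟨a, fun h' => absurd h' h⟩
  choose g hg using hg
  by_cases hcof : ∀ b ∈ B, ∃ c ∈ Set.range g, c ∈ B ∧ b ≤ c
  · exact ⟨_, mk_range_le.trans_lt hA, Or.inl hcof⟩
  push Not at hcof
  obtain ⟨b₀, hb₀, hb₀g⟩ := hcof
  have hA₀ : ∀ a ∈ A, b₀ ≤ a → ∀ b ∈ B, b ≤ a := by
    intro a ha hba b hb
    by_contra hba'
    obtain ⟨h₁, h₂⟩ := hg ⟨a, ha⟩ ⟨b, hb, hba'⟩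
    rcases hchain _ hb₀ _ h₁ with h | h
    · exact hb₀g _ ⟨_, rfl⟩ h₁ h
    · exact h₂ (h.trans hba)
  by_cases hV : ∃ c ∈ A, b₀ ≤ c
  · obtain ⟨c, hcA, hc⟩ := hV
    have hcB := hA₀ c hcA hc
    -- Meeting with `c` puts all bounds coming from `A` into the chain below `c`, where they can be
    -- compared with the complement of `B`.
    set V : Set U := (fun a => a ⊓ c) '' {a ∈ A | b₀ ≤ a} with hVdef
    have hVκ : #V < κ := mk_image_le.trans_lt
      ((mk_le_mk_of_subset (Set.sep_subset _ _)).trans_lt hA)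
    have hVup : ∀ v ∈ V, ∀ b ∈ B, b ≤ v := by
      rintro _ ⟨a, ⟨ha, hba⟩, rfl⟩ b hb
      exact le_inf (hA₀ a ha hba b hb) (hcB b hb)
    by_cases hmax : ∃ v ∈ V, v ∈ B
    · obtain ⟨v, hv, hvB⟩ := hmax
      exact ⟨{v}, hsmall v, Or.inl fun b hb => ⟨v, rfl, hvB, hVup v hv b hb⟩⟩
    push Not at hmax
    have hcV : c ∈ V := ⟨c, ⟨hcA, hc⟩, inf_idem _⟩
    by_cases hcoin : ∀ d ≤ c, d ∉ B → ∃ e ∈ V, e ∉ B ∧ e ≤ d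
    · exact ⟨V, hVκ, Or.inr ⟨c, hcV, hcB, hcoin⟩⟩
    push Not at hcoin
    obtain ⟨d, hdc, hdB, hd⟩ := hcoin
    by_cases hmin : ∃ d', d' < d ∧ d' ∉ B
    · exfalso
      obtain ⟨d', hd'd, hd'B⟩ := hmin
      have hb₀d' : b₀ ≤ d' := (hU.comparable hc (hd'd.le.trans hdc)).resolve_right
        fun h => hd'B (hlow h hb₀)
      -- This set contains `A`, since no element of `V` lies below `d`. It does not separate `b₀`
      -- from `d'`: its points are above both or branch off strictly below `b₀`.
      have hinf : InfClosed {a : U | d ≤ a ∨ ¬ b₀ ≤ a} := by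
        rintro a ha b hb
        by_cases h : b₀ ≤ a ⊓ b
        · exact Or.inl (le_inf (ha.resolve_right (not_not.2 (h.trans inf_le_left)))
            (hb.resolve_right (not_not.2 (h.trans inf_le_right))))
        · exact Or.inr h
      refine hd'B ((hinv _ hinf (fun a ha => ?_) b₀ d' fun a ha => ?_).1 hb₀)
      · by_cases hba : b₀ ≤ a
        · have hv : a ⊓ c ∈ V := ⟨a, ⟨ha, hba⟩, rfl⟩
          rcases hU.comparable hdc (inf_le_right : a ⊓ c ≤ c) with h | h
          · exact Or.inl (h.trans inf_le_left)
          · exact absurd h (hd _ hv (hmax _ hv))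
        · exact Or.inr hba
      · rcases ha with ha | ha
        · exact Or.inl ⟨lt_of_le_of_lt hb₀d' (hd'd.trans_le ha), hd'd.trans_le ha⟩
        · have h₁ : b₀ ⊓ a < b₀ := lt_of_le_of_ne inf_le_left fun h => ha (inf_eq_left.1 h)
          refine Or.inr ⟨le_antisymm (inf_le_inf_right _ hb₀d') (le_inf ?_ inf_le_right),
            Or.inr fun h => ha (h.trans inf_le_right), ?_⟩
          · rcases hU.comparable hb₀d' (inf_le_left : d' ⊓ a ≤ d') with h | h
            · exact absurd (h.trans inf_le_right) ha
            · exact h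
          · rwa [inf_eq_left.2 hb₀d']
    · push Not at hmin
      -- Here `d` is the least point outside `B` below `c`.
      refine ⟨{c} ∪ {d}, (mk_union_le _ _).trans_lt (add_lt_of_lt hκ (hsmall c) (hsmall d)),
        Or.inr ⟨c, Or.inl rfl, hcB, fun d' hd'c hd'B => ⟨d, Or.inr rfl, hdB, ?_⟩⟩⟩
      rcases hU.comparable hdc hd'c with h | h
      · exact h
      · exact (eq_of_le_of_not_lt h fun h' => hd'B (hmin d' h')).ge
  · exfalso
    push Not at hV
    have hinf : InfClosed {a : U | ¬ b₀ ≤ a} := fun a ha b _ h => ha (h.trans inf_le_left)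
    -- With nothing of `A` above `b₀`, all points above `b₀` look alike over `A`. Then `B` would
    -- contain two distinct open cones above `b₀`, although it is a chain.
    have hall : ∀ b, b₀ ≤ b → b ∈ B := by
      intro b hb
      refine (hinv _ hinf (fun a ha => hV a ha) b₀ b fun a ha => Or.inr ?_).1 hb₀
      have h₁ : b₀ ⊓ a < b₀ := lt_of_le_of_ne inf_le_left fun h => ha (inf_eq_left.1 h)
      refine ⟨le_antisymm (inf_le_inf_right _ hb) (le_inf ?_ inf_le_right),
        fun h => ha (h.trans inf_le_right), ?_⟩
      · rcases hU.comparable hb (inf_le_left : b ⊓ a ≤ b) with h | h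
        · exact absurd (h.trans inf_le_right) ha
        · exact h
      · rwa [inf_eq_left.2 hb]
    obtain ⟨y, hy, -⟩ := hU.cones b₀ ∅ Set.finite_empty
    obtain ⟨z, hz, hyz⟩ := hU.cones b₀ {y} (Set.finite_singleton y)
    have := hyz y rfl
    rcases hchain _ (hall y hy.le) _ (hall z hz.le) with h | h
    · exact this (by rwa [inf_eq_left.2 h])
    · exact this (by rwa [inf_eq_right.2 h])

end
end MeetTree

/-! ### The relations `R_j` and moves inside open cones -/

namespace MeetTree

section
variable {J : Type u} {U : Type w} [(Lrel J).Structure U]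

/-- The interpretation of `R_j`. -/
def RHolds (j : J) (x y : U) : Prop := Structure.RelMap (relSymb j) ![x, y]

theorem relMap_relSymb (j : J) (x : Fin 2 → U) :
    Structure.RelMap (relSymb j) x ↔ RHolds j (x 0) (x 1) := by
  apply Eq.to_iff
  unfold RHolds
  congr 1
  exact List.ofFn_inj.1 rfl

/-- Each `R_j` holds only between incomparable elements and depends only on their open cones. -/
def RespectsCones (J : Type u) (U : Type w) [(Lrel J).Structure U] [SemilatticeInf U] : Prop :=
  ∀ (j : J) (x y : U), (RHolds j x y → ¬ x ≤ y ∧ ¬ y ≤ x) ∧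
    ∀ x' y', ¬ x ≤ y → ¬ y ≤ x → x ⊓ y < x ⊓ x' → x ⊓ y < y ⊓ y' →
      (RHolds j x y ↔ RHolds j x' y')

variable [Lmt.Structure U]

theorem realize_R (j : J) {n : ℕ} (s t : (Lcone J).Term (Empty ⊕ Fin n)) (v : Empty → U)
    (xs : Fin n → U) : (R j s t).Realize v xs ↔
      RHolds j (s.realize (Sum.elim v xs)) (t.realize (Sum.elim v xs)) :=
  BoundedFormula.realize_rel₂

theorem models_DMT [Nonempty U] {T : (Lcone J).Theory}
    (hT : IsPurelyBinaryConeExpansion T) (hU : U ⊨ T) : U ⊨ DMT :=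
  ⟨fun σ hσ => (LHom.realize_onSentence U (incl J) σ).1 ((hT.dmt σ hσ).realize_sentence U)⟩

variable [SemilatticeInf U] [CompatibleOrder U]

theorem realize_par {n : ℕ} (s t : Lmt.Term (Empty ⊕ Fin n)) (v : Empty → U) (xs : Fin n → U) :
    (par s t).Realize v xs ↔ ¬ s.realize (Sum.elim v xs) ≤ t.realize (Sum.elim v xs) ∧
      ¬ t.realize (Sum.elim v xs) ≤ s.realize (Sum.elim v xs) := by
  rw [par, BoundedFormula.realize_inf, BoundedFormula.realize_not, BoundedFormula.realize_not,
    realize_le, realize_le, CompatibleOrder.relMap_lt, CompatibleOrder.relMap_lt,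
    le_iff_lt_or_eq, le_iff_lt_or_eq]

theorem IsPurelyBinaryConeExpansion.respectsCones [Nonempty U] {T : (Lcone J).Theory}
    (hT : IsPurelyBinaryConeExpansion T) (hU : U ⊨ T) : RespectsCones J U := by
  intro j x y
  constructor
  · intro h
    have := BoundedFormula.realize_alls.1 ((hT.par j).realize_sentence U) ![x, y]
    simp only [BoundedFormula.realize_imp, realize_R, LHom.realize_onBoundedFormula,
      realize_par] at this
    exact this h
  · intro x' y' h₁ h₂ h₃ h₄
    have := BoundedFormula.realize_alls.1 ((hT.cone j).realize_sentence U) ![x, y, x', y']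
    simp only [BoundedFormula.realize_imp, realize_R, LHom.realize_onBoundedFormula,
      realize_par, BoundedFormula.realize_inf, BoundedFormula.realize_iff, realize_lt,
      CompatibleOrder.relMap_lt, realize_meet, CompatibleOrder.funMap_meet] at this
    exact this ⟨⟨⟨h₁, h₂⟩, h₃⟩, h₄⟩

/-- Since the `R_j` are binary, only the pairs formed by `b` and a point `a` of `D` need attention.
Either `a` is comparable with both `b` and `b'`, so that no `R_j` holds, or `b` and `b'` lie in the
same open cone above `b ⊓ a` and `R_j` cannot tell them apart. -/
theorem ConeEquivOver.isAtomicRelation (hR : RespectsCones J U) {D : Set U} (hD : InfClosed D)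
    {b b' : U} (h : ConeEquivOver D b b') :
    IsAtomicRelation (Lcone J) (insert (b, b') ((fun a => (a, a)) '' D)) := by
  have hdiag : IsPartialIso ((fun a => (a, a)) '' D) := by
    refine ⟨?_, ?_⟩
    · rintro _ ⟨a, ha, rfl⟩ _ ⟨a', ha', rfl⟩
      exact ⟨a ⊓ a', hD ha ha', rfl⟩
    · rintro _ _ _ _ ⟨a, ha, h₁⟩ ⟨a', ha', h₂⟩
      cases h₁; cases h₂; rfl
  have hE := (hdiag.insert (d := b) (d' := b') (by
    rintro x y ⟨a, ha, h₁⟩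
    have hx : a = x := (Prod.mk.inj h₁).1
    have hy : a = y := (Prod.mk.inj h₁).2
    subst hx hy
    rcases h a ha with h' | ⟨h₁, h₂, h₃⟩
    · exact Or.inl h'
    · refine Or.inr ⟨⟨b ⊓ a, h₂, by rw [Prod.mk.injEq]; exact ⟨rfl, h₁⟩⟩, fun hb => ?_, fun hb => ?_⟩
      · exact h₃.not_ge (inf_le_left.trans (le_inf le_rfl hb))
      · exact h₃.not_ge (inf_le_right.trans (h₁ ▸ le_inf le_rfl hb)))).isAtomicRelation
  have hinc : ∀ (j : J) (a : U), a ∈ D → ∀ {x y x' y' : U}, (x, x') = (b, b') → (y, y') = (a, a) →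
      (RHolds j x y ↔ RHolds j x' y') ∧ (RHolds j y x ↔ RHolds j y' x') := by
    intro j a ha x y x' y' hx hy
    cases hx; cases hy
    rcases h a ha with ⟨h₁, h₂⟩ | ⟨h₁, h₂, h₃⟩
    · exact ⟨iff_of_false (fun h' => ((hR j _ _).1 h').1 h₁.le) fun h' => ((hR j _ _).1 h').1 h₂.le,
        iff_of_false (fun h' => ((hR j _ _).1 h').2 h₁.le) fun h' => ((hR j _ _).1 h').2 h₂.le⟩
    · have hba : ¬ b ≤ a := fun hb => h₃.not_ge (inf_le_left.trans (le_inf le_rfl hb))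
      by_cases hab : a ≤ b
      · have hab' : a ≤ b' := by
          rw [inf_eq_right.2 hab] at h₁
          exact h₁.le.trans inf_le_left
        exact ⟨iff_of_false (fun h' => ((hR j _ _).1 h').2 hab) fun h' => ((hR j _ _).1 h').2 hab',
          iff_of_false (fun h' => ((hR j _ _).1 h').1 hab) fun h' => ((hR j _ _).1 h').1 hab'⟩
      · have h₄ : b ⊓ a < a ⊓ a := by
          rw [inf_idem]
          exact lt_of_le_of_ne inf_le_right fun h' => hab (inf_eq_right.1 h')
        exact ⟨(hR j b a).2 b' a hba hab h₃ h₄,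
          (hR j a b).2 a b' hab hba (inf_comm b a ▸ h₄) (inf_comm b a ▸ h₃)⟩
  refine ⟨?_, ?_, hE.eq_iff⟩
  · rintro k (f | f) x y hxy
    · exact hE.funMap_mem f x y hxy
    · exact f.elim
  · rintro k (r | r) x y hxy
    · exact hE.relMap_iff r x y hxy
    · cases r with
      | rel j =>
        refine (relMap_relSymb j x).trans (Iff.trans ?_ (relMap_relSymb j y).symm)
        rcases hxy 0 with h₀ | ⟨a, ha, h₀⟩ <;> rcases hxy 1 with h₁ | ⟨a', ha', h₁⟩
        · obtain ⟨h₂, h₃⟩ := Prod.mk.inj (h₀.trans h₁.symm)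
          exact iff_of_false (fun h' => ((hR j _ _).1 h').1 h₂.le)
            fun h' => ((hR j _ _).1 h').1 h₃.le
        · exact (hinc j a' ha' h₀ h₁.symm).1
        · exact (hinc j a ha h₁ h₀.symm).2
        · rw [(Prod.mk.inj h₀).1.symm.trans (Prod.mk.inj h₀).2,
            (Prod.mk.inj h₁).1.symm.trans (Prod.mk.inj h₁).2]

theorem ConeEquivOver.sameType [Nonempty U] {T : (Lcone J).Theory}
    (hT : IsPurelyBinaryConeExpansion T) (hU : U ⊨ T) {A D : Set U} (hD : InfClosed D)
    (hAD : A ⊆ D) {b b' : U} (h : ConeEquivOver D b b') :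
    InvType.SameType (Lcone J) U A ![b] ![b'] := by
  intro φ
  rw [Formula.Realize, Formula.Realize, ← BoundedFormula.realize_constantsVarsEquiv,
    ← BoundedFormula.realize_constantsVarsEquiv]
  refine (h.isAtomicRelation (hT.respectsCones hU) hD).realize_iff_of_eliminatesQuantifiers
    hT.qe hU hU (BoundedFormula.constantsVarsEquiv φ) ?_
  rintro (a | i)
  · exact Or.inr ⟨a, hAD a.2, rfl⟩
  · rw [Subsingleton.elim i 0]
    exact Or.inl rfl

end
end MeetTree

/-! ### Small sets determining a finite subtree over `U` -/

namespace MeetTree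

/-- A property of parameter sets that is preserved upwards and holds of a small set for each of
finitely many indices holds of a common small set. -/
theorem exists_small_of_finite {U : Type w} {κ : Cardinal.{w}} (hκ : ℵ₀ ≤ κ) {ι : Type*}
    {I : Set ι} (hI : I.Finite) {Q : ι → Set U → Prop}
    (hmono : ∀ i A A', A ⊆ A' → Q i A → Q i A')
    (h : ∀ i ∈ I, ∃ A : Set U, #A < κ ∧ Q i A) : ∃ A : Set U, #A < κ ∧ ∀ i ∈ I, Q i A := by
  induction I, hI using Set.Finite.induction_on with
  | empty => exact ⟨∅, by simpa using aleph0_pos.trans_le hκ, by simp⟩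
  | @insert i I _ _ ih =>
    obtain ⟨A, hA, hQ⟩ := ih fun j hj => h j (Or.inr hj)
    obtain ⟨A', hA', hQ'⟩ := h i (Or.inl rfl)
    refine ⟨A ∪ A', (mk_union_le _ _).trans_lt (add_lt_of_lt hκ hA hA'), ?_⟩
    rintro j (rfl | hj)
    · exact hmono _ _ _ Set.subset_union_right hQ'
    · exact hmono _ _ _ Set.subset_union_left (hQ j hj)

theorem exists_small_witness {U : Type w} {κ : Cardinal.{w}} (hκ : ℵ₀ ≤ κ) (P : U → Prop) :
    ∃ A : Set U, #A < κ ∧ ((∃ a, P a) → ∃ a ∈ A, P a) := by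
  by_cases h : ∃ a, P a
  · obtain ⟨a, ha⟩ := h
    exact ⟨{a}, (mk_singleton a).trans_lt (one_lt_aleph0.trans_le hκ), fun _ => ⟨a, rfl, ha⟩⟩
  · exact ⟨∅, by simpa using aleph0_pos.trans_le hκ, fun h' => absurd h' h⟩

theorem IsDenseMeetTree.lt_inf {α : Type*} [SemilatticeInf α] (hα : IsDenseMeetTree α)
    {x y z t : α} (hy : x < y) (hz : x < z) (hyt : y ≤ t) (hzt : z ≤ t) : x < y ⊓ z := by
  rcases hα.comparable hyt hzt with h | h
  · rwa [inf_eq_left.2 h]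
  · rwa [inf_eq_right.2 h]

section
variable {U : Type*} {N : Type*} [SemilatticeInf U] [SemilatticeInf N]

/-- The points of the subtree `U` below `u`. -/
def cutBelow (h : U → N) (u : N) : Set U := {a | h a ≤ u}

/-- The parameters `A` determine the position of the set `C` over the subtree `U`. -/
structure Determines (h : U → N) (C : Set N) (A : Set U) : Prop where
  cut : ∀ u ∈ C, ControlsCut A (cutBelow h u)
  image : ∀ u ∈ C, (∃ a, h a = u) → ∃ a ∈ A, h a = u
  greatest : ∀ u ∈ C, (∃ a, IsGreatest (cutBelow h u) a) → ∃ a ∈ A, IsGreatest (cutBelow h u) a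
  above : ∀ u ∈ C, (∃ a, u ≤ h a) → ∃ a ∈ A, u ≤ h a
  cone_greatest : ∀ u ∈ C, (∃ a, ∃ b, IsGreatest (cutBelow h u) b ∧ h b < u ⊓ h a) →
    ∃ a ∈ A, ∃ b, IsGreatest (cutBelow h u) b ∧ h b < u ⊓ h a
  cone : ∀ u ∈ C, ∀ w ∈ C, (∃ a, w < u ⊓ h a) → ∃ a ∈ A, w < u ⊓ h a

variable {h : U → N} {C : Set N} {A : Set U} {F : Set (U × U)}

section
variable (hU : IsDenseMeetTree U) (hN : IsDenseMeetTree N) (hinf : ∀ a b, h (a ⊓ b) = h a ⊓ h b)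
  (hle : ∀ {a b}, h a ≤ h b ↔ a ≤ b) (hdet : Determines h C A) (hF : IsPartialIso F)
  (hFA : ∀ a ∈ A, (a, a) ∈ F)
include hdet hF hFA

/-- A parameter of the cut above `a` is also above `b`. In the other case, if `b` were outside the
cut, a parameter outside it would lie below `b`, hence below `a`. -/
theorem Determines.map_le {u : N} (hu : u ∈ C) (hle : ∀ {a b}, h a ≤ h b ↔ a ≤ b) {a b : U}
    (hab : (a, b) ∈ F) (ha : h a ≤ u) : h b ≤ u := by
  rcases hdet.cut u hu with H | ⟨c, hc, H₁, H₂⟩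
  · obtain ⟨c, hc, hcu, hac⟩ := H a ha
    exact (hle.2 ((hF.le_iff hab (hFA c hc)).1 hac)).trans hcu
  · by_contra hb
    obtain ⟨e, he, heu, heb⟩ := H₂ b ((hF.le_iff hab (hFA c hc)).1 (H₁ a ha)) hb
    exact heu ((hle.2 ((hF.le_iff (hFA e he) hab).2 heb)).trans ha)

include hN hinf hle in
theorem Determines.le_map {u : N} (hu : u ∈ C) {a b : U} (hab : (a, b) ∈ F) (ha : u ≤ h a) :
    u ≤ h b := by
  by_cases him : ∃ g, h g = u
  · obtain ⟨g, hg, rfl⟩ := hdet.image u hu him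
    exact hle.2 ((hF.le_iff (hFA g hg) hab).1 (hle.1 ha))
  obtain ⟨c, hc, huc⟩ := hdet.above u hu ⟨a, ha⟩
  have hm := hF.inf_mem hab (hFA c hc)
  -- Otherwise `h (a ⊓ c) ≤ u` by the inverse of `F`, so `u` would equal `h (a ⊓ c)`.
  have h₁ : ¬ h (b ⊓ c) ≤ u := fun hbc => him ⟨a ⊓ c, le_antisymm
    (hdet.map_le hF.swap hFA hu hle (a := b ⊓ c) (b := a ⊓ c) hm hbc)
    (hinf a c ▸ le_inf ha huc)⟩
  rcases hN.comparable huc (hle.2 inf_le_right : h (b ⊓ c) ≤ h c) with h₂ | h₂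
  · exact h₂.trans (hle.2 inf_le_left)
  · exact absurd h₂ h₁

include hU hN hinf hle in
theorem Determines.map_lt_inf {u : N} (hu : u ∈ C) {a b a' b' : U} (hab : (a, b) ∈ F)
    (hab' : (a', b') ∈ F) (hlt : h a' < u ⊓ h a) : h b' < u ⊓ h b := by
  have hlt_iff : ∀ {a b}, h a < h b ↔ a < b := by
    intro a b
    rw [lt_iff_le_not_ge, lt_iff_le_not_ge, hle, hle]
  have ha'u : h a' ≤ u := hlt.le.trans inf_le_left
  have hb'u : h b' ≤ u := hdet.map_le hF hFA hu hle hab' ha'u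
  -- A greatest element of the cut is a parameter, hence fixed by `F`, and the open cone of `u`
  -- above it is then tested by a parameter. Otherwise the cut has points strictly above `a'` and
  -- above `b'`, and the control of the cut suffices.
  by_cases hmax : IsGreatest (cutBelow h u) a' ∨ IsGreatest (cutBelow h u) b'
  · obtain ⟨g, hg, hgmax⟩ := hdet.greatest u hu (hmax.elim (fun h => ⟨_, h⟩) fun h => ⟨_, h⟩)
    have hga : a' = g := hmax.elim (fun H => H.unique hgmax) fun H =>
      (hF.eq_iff hab' (hFA g hg)).2 (H.unique hgmax)
    have hgb : b' = g := (hF.eq_iff hab' (hFA g hg)).1 hga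
    subst hga
    obtain ⟨c, hc, d, hd, hdc⟩ := hdet.cone_greatest u hu ⟨a, a', hgmax, hlt⟩
    obtain rfl := hd.unique hgmax
    rw [hgb]
    have h₁ : h d < h (a ⊓ c) := (hN.lt_inf hlt hdc inf_le_left inf_le_left).trans_le
      (hinf a c ▸ inf_le_inf inf_le_right inf_le_right)
    have h₂ : h d < h (b ⊓ c) := hlt_iff.2 ((hF.lt_iff (hFA d hg) (hF.inf_mem hab (hFA c hc))).1
      (hlt_iff.1 h₁))
    exact (hN.lt_inf h₂ hdc (hle.2 inf_le_right) inf_le_right).trans_le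
      (le_inf (inf_le_right.trans inf_le_left) (inf_le_left.trans (hle.2 inf_le_left)))
  · have hnext : ∀ a, h a ≤ u → ¬ IsGreatest (cutBelow h u) a → ∃ b, h b ≤ u ∧ a < b := by
      intro a ha hmax
      by_contra! H
      refine hmax ⟨ha, fun b hb => ?_⟩
      rcases hN.comparable ha hb with h' | h'
      · exact (eq_of_le_of_not_lt (hle.1 h') (H b hb)).ge
      · exact hle.1 h'
    obtain ⟨a₁, ha₁u, ha₁⟩ := hnext a' ha'u fun H => hmax (Or.inl H)
    obtain ⟨b₁, hb₁u, hb₁⟩ := hnext b' hb'u fun H => hmax (Or.inr H)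
    rcases hdet.cut u hu with H | ⟨c, hc, H₁, -⟩
    · obtain ⟨c, hc, hcu, hac⟩ := H a₁ ha₁u
      have h₁ : h a' < h (a ⊓ c) := (hN.lt_inf hlt (hlt_iff.2 (ha₁.trans_le hac)) inf_le_left
        hcu).trans_le (hinf a c ▸ inf_le_inf_right _ inf_le_right)
      have h₂ : h b' < h (b ⊓ c) := hlt_iff.2 ((hF.lt_iff hab' (hF.inf_mem hab (hFA c hc))).1
        (hlt_iff.1 h₁))
      exact h₂.trans_le (le_inf ((hle.2 inf_le_right).trans hcu) (hle.2 inf_le_left))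
    · have h₁ : h a' < h (a ⊓ c) := (hN.lt_inf hlt (hlt_iff.2 ha₁) inf_le_left
        ha₁u).trans_le (hinf a c ▸ inf_le_inf inf_le_right (hle.2 (H₁ a₁ ha₁u)))
      have h₂ : b' < b ⊓ c := (hF.lt_iff hab' (hF.inf_mem hab (hFA c hc))).1 (hlt_iff.1 h₁)
      have h₃ : b' < (b ⊓ c) ⊓ b₁ := hU.lt_inf h₂ hb₁ inf_le_right (H₁ b₁ hb₁u)
      exact (hlt_iff.2 h₃).trans_le (le_inf ((hle.2 inf_le_right).trans hb₁u)
        (hle.2 (inf_le_left.trans inf_le_left)))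

include hU hN hinf hle in
-- The parameter `c` marks the open cone of `u` above `w`. If `w` is not in the image of `h`,
-- `Determines.le_map` carries `w ≤ h (a ⊓ c)` over to `b`, and the inequality is automatically
-- strict.
theorem Determines.lt_inf_map {u w : N} (hu : u ∈ C) (hw : w ∈ C) {a b : U} (hab : (a, b) ∈ F)
    (hlt : w < u ⊓ h a) : w < u ⊓ h b := by
  by_cases him : ∃ g, h g = w
  · obtain ⟨g, hg, rfl⟩ := hdet.image w hw him
    exact hdet.map_lt_inf hU hN hinf hle hF hFA hu hab (hFA g hg) hlt
  obtain ⟨c, hc, hwc⟩ := hdet.cone u hu w hw ⟨a, hlt⟩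
  have h₁ : w ≤ h (a ⊓ c) := (hN.lt_inf hlt hwc inf_le_left inf_le_left).le.trans
    (hinf a c ▸ inf_le_inf inf_le_right inf_le_right)
  have h₂ : w < h (b ⊓ c) := lt_of_le_of_ne
    (hdet.le_map hN hinf hle hF hFA hw (hF.inf_mem hab (hFA c hc)) h₁) fun H => him ⟨_, H.symm⟩
  exact (hN.lt_inf h₂ hwc (hle.2 inf_le_right) inf_le_right).trans_le
    (le_inf (inf_le_right.trans inf_le_left) (inf_le_left.trans (hle.2 inf_le_left)))

end

end

/-! ### Amalgamating a partial isomorphism of `U` with the identity of `C` -/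

section
variable {U : Type*} {N : Type*} [SemilatticeInf N] {h : U → N} {C : Set N} {F : Set (U × U)}

/-- The relation generated by a relation `F` on `U` and the identity of `C`. -/
inductive Amalgam (h : U → N) (C : Set N) (F : Set (U × U)) : N × N → Prop
  | left {u} : u ∈ C → Amalgam h C F (u, u)
  | right {a b} : (a, b) ∈ F → Amalgam h C F (h a, h b)
  | both {u a b} : u ∈ C → (a, b) ∈ F → Amalgam h C F (u ⊓ h a, u ⊓ h b)

theorem Amalgam.swap {p : N × N} (hp : Amalgam h C F p) :
    Amalgam h C (Prod.swap ⁻¹' F) p.swap := by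
  cases hp with
  | left hu => exact .left hu
  | right hab => exact .right hab
  | both hu hab => exact .both hu hab

theorem Amalgam.mono {F' : Set (U × U)} (hF : F ⊆ F') {p : N × N} (hp : Amalgam h C F p) :
    Amalgam h C F' p := by
  cases hp with
  | left hu => exact .left hu
  | right hab => exact .right (hF hab)
  | both hu hab => exact .both hu (hF hab)

theorem Amalgam.finite (hC : C.Finite) (hF : F.Finite) : {p | Amalgam h C F p}.Finite := by
  refine ((hC.image fun u => (u, u)).union ((hF.image fun p => (h p.1, h p.2)).union
    ((hC.prod hF).image fun q => (q.1 ⊓ h q.2.1, q.1 ⊓ h q.2.2)))).subset ?_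
  rintro _ (hu | hab | ⟨hu, hab⟩)
  · exact Or.inl ⟨_, hu, rfl⟩
  · exact Or.inr (Or.inl ⟨_, hab, rfl⟩)
  · exact Or.inr (Or.inr ⟨(_, _, _), ⟨hu, hab⟩, rfl⟩)

end

section
variable {U : Type*} {N : Type*} [SemilatticeInf U] [SemilatticeInf N] {h : U → N} {C : Set N}
  {A : Set U} {F : Set (U × U)}

theorem Amalgam.inf (hinf : ∀ a b, h (a ⊓ b) = h a ⊓ h b) (hC : InfClosed C) (hF : InfClosed F)
    {p q : N × N} (hp : Amalgam h C F p) (hq : Amalgam h C F q) : Amalgam h C F (p ⊓ q) := by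
  have hF' : ∀ {a b a' b'}, (a, b) ∈ F → (a', b') ∈ F → (a ⊓ a', b ⊓ b') ∈ F :=
    fun h₁ h₂ => hF h₁ h₂
  rcases hp with hu | hab | ⟨hu, hab⟩ <;> rcases hq with hu' | hab' | ⟨hu', hab'⟩ <;>
    rw [Prod.mk_inf_mk]
  · exact .left (hC hu hu')
  · exact .both hu hab'
  · simpa only [inf_assoc] using Amalgam.both (h := h) (hC hu hu') hab'
  · simpa only [inf_comm] using Amalgam.both (h := h) hu' hab
  · simpa only [hinf] using Amalgam.right (h := h) (C := C) (hF' hab hab')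
  · simpa only [hinf, inf_left_comm] using Amalgam.both (h := h) hu' (hF' hab hab')
  · simpa only [inf_right_comm] using Amalgam.both (h := h) (hC hu hu') hab
  · simpa only [hinf, inf_assoc] using Amalgam.both (h := h) hu (hF' hab hab')
  · simpa only [hinf, inf_inf_inf_comm] using Amalgam.both (h := h) (hC hu hu') (hF' hab hab')

/-- It is enough to bound by points of `C` and by points of the image of `h`. When the left side is
a mixed meet, a failure on the image side is a strict inequality between two points of a chain, and
the inverse of `F` pulls it back to contradict the assumption. -/
theorem Determines.amalgam_le (hU : IsDenseMeetTree U) (hN : IsDenseMeetTree N)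
    (hinf : ∀ a b, h (a ⊓ b) = h a ⊓ h b) (hle : ∀ {a b}, h a ≤ h b ↔ a ≤ b)
    (hC : InfClosed C) (hdet : Determines h C A) (hF : IsPartialIso F)
    (hFA : ∀ a ∈ A, (a, a) ∈ F) {p q : N × N} (hp : Amalgam h C F p) (hq : Amalgam h C F q)
    (hpq : p.1 ≤ q.1) : p.2 ≤ q.2 := by
  have h₁ : ∀ u ∈ C, p.1 ≤ u → p.2 ≤ u := by
    intro u hu hpu
    rcases hp with hw | hab | @⟨w, a, b, hw, hab⟩
    · exact hpu
    · exact hdet.map_le hF hFA hu hle hab hpu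
    · by_contra H
      have hlt : w ⊓ u < w ⊓ h b := by
        rcases hN.comparable (inf_le_left : w ⊓ u ≤ w) (inf_le_left : w ⊓ h b ≤ w) with h' | h'
        · exact lt_of_le_not_ge h' fun h'' => H (h''.trans inf_le_right)
        · exact absurd (h'.trans inf_le_right) H
      exact (hdet.lt_inf_map hU hN hinf hle hF.swap hFA hw (hC hw hu) (a := b) (b := a) hab
        hlt).not_ge (le_inf inf_le_left hpu)
  have h₂ : ∀ {a' b'}, (a', b') ∈ F → p.1 ≤ h a' → p.2 ≤ h b' := by
    intro a' b' hab' hpa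
    rcases hp with hw | hab | @⟨w, a, b, hw, hab⟩
    · exact hdet.le_map hN hinf hle hF hFA hw hab' hpa
    · exact hle.2 ((hF.le_iff hab hab').1 (hle.1 hpa))
    · by_contra H
      have hlt : h (b ⊓ b') < w ⊓ h b := by
        rcases hN.comparable (hle.2 inf_le_left : h (b ⊓ b') ≤ h b)
          (inf_le_right : w ⊓ h b ≤ h b) with h' | h'
        · exact lt_of_le_not_ge h' fun h'' => H (h''.trans (hle.2 inf_le_right))
        · exact absurd (h'.trans (hle.2 inf_le_right)) H
      refine (hdet.map_lt_inf hU hN hinf hle hF.swap hFA hw (a := b) (b := a) (a' := b ⊓ b')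
        (b' := a ⊓ a') hab (hF.inf_mem hab hab') hlt).not_ge ?_
      rw [hinf]
      exact le_inf inf_le_right hpa
  rcases hq with hu | hab | ⟨hu, hab⟩
  · exact h₁ _ hu hpq
  · exact h₂ hab hpq
  · exact le_inf (h₁ _ hu (hpq.trans inf_le_left)) (h₂ hab (hpq.trans inf_le_right))

/-- `F` fixes all of `A` and may be infinite, whereas back and forth needs a finite relation; hence
the restriction to `F'`, which need not contain the diagonal of `A`. -/
theorem Determines.isPartialIso_amalgam (hU : IsDenseMeetTree U) (hN : IsDenseMeetTree N)
    (hinf : ∀ a b, h (a ⊓ b) = h a ⊓ h b) (hle : ∀ {a b}, h a ≤ h b ↔ a ≤ b)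
    (hC : InfClosed C) (hdet : Determines h C A) (hF : IsPartialIso F)
    (hFA : ∀ a ∈ A, (a, a) ∈ F) {F' : Set (U × U)} (hF' : InfClosed F') (hsub : F' ⊆ F) :
    IsPartialIso {p | Amalgam h C F' p} :=
  ⟨fun _ hp _ hq => hp.inf hinf hC hF' hq, fun hp hq =>
    ⟨hdet.amalgam_le hU hN hinf hle hC hF hFA (hp.mono hsub) (hq.mono hsub),
      hdet.amalgam_le hU hN hinf hle hC hF.swap hFA (hp.mono hsub).swap (hq.mono hsub).swap⟩⟩

end

theorem exists_determines {U : Type w} {N : Type*} [SemilatticeInf U] [SemilatticeInf N]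
    {κ : Cardinal.{w}} (hκ : ℵ₀ ≤ κ) {h : U → N} {C : Set N} (hC : C.Finite)
    (hcut : ∀ u ∈ C, ∃ A : Set U, #A < κ ∧ ControlsCut A (cutBelow h u)) :
    ∃ A : Set U, #A < κ ∧ Determines h C A := by
  have wit : ∀ {ι : Type _} {I : Set ι} (_ : I.Finite) (P : ι → U → Prop),
      ∃ A : Set U, #A < κ ∧ ∀ i ∈ I, (∃ a, P i a) → ∃ a ∈ A, P i a := fun hI P =>
    exists_small_of_finite hκ hI (fun i A A' hA H ha => let ⟨a, h₁, h₂⟩ := H ha; ⟨a, hA h₁, h₂⟩)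
      fun i _ => exists_small_witness hκ (P i)
  obtain ⟨A₀, hA₀, H₀⟩ := exists_small_of_finite hκ hC
    (Q := fun u A => ControlsCut A (cutBelow h u)) (fun _ _ _ hA H => H.mono hA) hcut
  obtain ⟨A₁, hA₁, H₁⟩ := wit hC fun u a => h a = u
  obtain ⟨A₂, hA₂, H₂⟩ := wit hC fun u a => IsGreatest (cutBelow h u) a
  obtain ⟨A₃, hA₃, H₃⟩ := wit hC fun u a => u ≤ h a
  obtain ⟨A₄, hA₄, H₄⟩ := wit hC fun u a => ∃ b, IsGreatest (cutBelow h u) b ∧ h b < u ⊓ h a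
  obtain ⟨A₅, hA₅, H₅⟩ := exists_small_of_finite hκ (hC.prod hC)
    (Q := fun p A => (∃ a, p.2 < p.1 ⊓ h a) → ∃ a ∈ A, p.2 < p.1 ⊓ h a)
    (fun i A A' hA H ha => let ⟨a, h₁, h₂⟩ := H ha; ⟨a, hA h₁, h₂⟩)
    fun i _ => exists_small_witness hκ _
  have add : ∀ {A A' : Set U}, #A < κ → #A' < κ → #(A ∪ A' : Set U) < κ := fun hA hA' =>
    (mk_union_le _ _).trans_lt (add_lt_of_lt hκ hA hA')
  refine ⟨A₀ ∪ A₁ ∪ A₂ ∪ A₃ ∪ A₄ ∪ A₅, add (add (add (add (add hA₀ hA₁) hA₂) hA₃) hA₄) hA₅,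
    fun u hu => (H₀ u hu).mono fun a ha => ?_, fun u hu he => ?_, fun u hu he => ?_,
    fun u hu he => ?_, fun u hu he => ?_, fun u hu w hw he => ?_⟩
  · simp [ha]
  · obtain ⟨a, h₁, h₂⟩ := H₁ u hu he
    exact ⟨a, by simp [h₁], h₂⟩
  · obtain ⟨a, h₁, h₂⟩ := H₂ u hu he
    exact ⟨a, by simp [h₁], h₂⟩
  · obtain ⟨a, h₁, h₂⟩ := H₃ u hu he
    exact ⟨a, by simp [h₁], h₂⟩
  · obtain ⟨a, h₁, h₂⟩ := H₄ u hu he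
    exact ⟨a, by simp [h₁], h₂⟩
  · obtain ⟨a, h₁, h₂⟩ := H₅ (u, w) ⟨hu, hw⟩ he
    exact ⟨a, by simp [h₁], h₂⟩

end MeetTree

/-! ### Partial isomorphisms from equality of types, and the theorem -/

namespace MeetTree

section
variable {U : Type w} [Lmt.Structure U] [SemilatticeInf U] [CompatibleOrder U]

theorem exists_term_of_mem_infClosure {ι : Type*} {c : ι → U} {u : U}
    (hu : u ∈ infClosure (Set.range c)) : ∃ t : Lmt.Term ι, t.realize c = u := by
  refine infClosure_min (t := {u | ∃ t : Lmt.Term ι, t.realize c = u}) ?_ ?_ hu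
  · rintro _ ⟨i, rfl⟩
    exact ⟨Term.var i, rfl⟩
  · rintro _ ⟨t, rfl⟩ _ ⟨s, rfl⟩
    exact ⟨Functions.apply₂ meetSymb t s, by
      rw [Term.realize_functions_apply₂, CompatibleOrder.funMap_meet]⟩

/-- Two tuples with the same type over `A` are exchanged by a partial isomorphism fixing `A`. -/
theorem exists_isPartialIso_of_sameType {A : Set U} {m : ℕ} {a b : Fin m → U}
    (hab : InvType.SameType Lmt U A a b) :
    ∃ F : Set (U × U), IsPartialIso F ∧ (∀ c ∈ A, (c, c) ∈ F) ∧ ∀ i, (a i, b i) ∈ F := by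
  have real : ∀ (t s : Lmt[[A]].Term (Fin m)) (x : Fin m → U),
      (Functions.apply₂ ((Lmt.lhomWithConstants A).onFunction meetSymb) t s).realize x =
        t.realize x ⊓ s.realize x := fun t s x => by
    rw [Term.realize_functions_apply₂, LHom.map_onFunction, CompatibleOrder.funMap_meet]
  refine ⟨Set.range fun t : Lmt[[A]].Term (Fin m) => (t.realize a, t.realize b), ⟨?_, ?_⟩,
    fun c hc => ⟨(Lmt.con (⟨c, hc⟩ : A)).term, ?_⟩, fun i => ⟨Term.var i, rfl⟩⟩
  · rintro _ ⟨t, rfl⟩ _ ⟨s, rfl⟩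
    exact ⟨Functions.apply₂ ((Lmt.lhomWithConstants A).onFunction meetSymb) t s,
      Prod.ext (real t s a) (real t s b)⟩
  · rintro _ _ _ _ ⟨t, ht⟩ ⟨s, hs⟩
    cases ht; cases hs
    have := hab (Term.equal (Functions.apply₂ ((Lmt.lhomWithConstants A).onFunction meetSymb) t s) t)
    rwa [Formula.realize_equal, Formula.realize_equal, real, real, inf_eq_left,
      inf_eq_left] at this
  · simp [Term.realize_constants]

end

end MeetTree

theorem corollary4 {J : Type u} (T : (MeetTree.Lcone J).Theory)
    (hT : MeetTree.IsPurelyBinaryConeExpansion T)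
    (κ : Cardinal.{w}) (hκ : ℵ₀ ≤ κ)
    (U : Type w) [Nonempty U] [MeetTree.Lmt.Structure U] [(MeetTree.Lrel J).Structure U]
    (hU : U ⊨ T) (hsat : InvType.IsSaturated (MeetTree.Lcone J) U κ)
    {n : ℕ} (p : InvType.GlobalType (MeetTree.Lcone J) U n) (hp : InvType.IsInvariant κ p) :
    InvType.IsInvariant κ (InvType.reductType (MeetTree.incl J) p) := by
  open MeetTree InvType in
  obtain ⟨A, hA, hinv⟩ := hp
  obtain ⟨N, _, h, c, hreal⟩ := exists_elementaryEmbedding_realize (reductType (incl J) p)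
  have hUD := models_DMT hT hU
  have hND : N ⊨ DMT := (h.theory_model_iff DMT).1 hUD
  have : Nonempty N := ‹Nonempty U›.map h
  obtain ⟨_, _, hUt⟩ := exists_semilatticeInf hUD
  obtain ⟨_, _, hNt⟩ := exists_semilatticeInf hND
  have hinf : ∀ a b, h (a ⊓ b) = h a ⊓ h b := fun a b => by
    rw [← CompatibleOrder.funMap_meet, h.map_fun, funMap_meetSymb]
    rfl
  have hle : ∀ {a b}, h a ≤ h b ↔ a ≤ b := by
    intro a b
    rw [← inf_eq_left, ← hinf, h.injective.eq_iff, inf_eq_left]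
  set C := infClosure (Set.range c) with hCdef
  have hCfin : C.Finite := (Set.finite_range c).infClosure
  have hcut : ∀ u ∈ C, ∃ A' : Set U, #A' < κ ∧ ControlsCut A' (cutBelow h u) := by
    intro u hu
    refine exists_controlsCut hUt hκ hA (fun a b hba ha => (hle.2 hba).trans ha)
      (fun a ha b hb => ?_) fun D hD hAD b b' hbb' => ?_
    · rw [← hle, ← hle (a := b)]
      exact hNt.comparable ha hb
    · obtain ⟨t, rfl⟩ := exists_term_of_mem_infClosure hu
      -- Since `u` is the value of a term `t` at `c`, the cut below `u` is defined by the formula `y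
      -- ⊓ t(x) = y` with one parameter, to which the invariance of `p` applies.
      have key : ∀ b : U, (Term.equal (Functions.apply₂ meetSymb (Term.var (Sum.inr (0 : Fin 1)))
          (t.relabel Sum.inl)) (Term.var (Sum.inr (0 : Fin 1)))).Realize
            (Sum.elim c (h ∘ ![b])) ↔ b ∈ cutBelow h (t.realize c) := fun b => by
        rw [Formula.realize_equal, Term.realize_functions_apply₂, CompatibleOrder.funMap_meet,
          inf_eq_left, Term.realize_relabel]
        rfl
      rw [← key, ← key, ← hreal, ← hreal, mem_reductType_iff, mem_reductType_iff]
      exact hinv 1 _ _ _ (hbb'.sameType hT hU hD hAD)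
  obtain ⟨A', hA', hdet⟩ := exists_determines hκ hCfin hcut
  refine ⟨A', hA', fun m φ a b hab => ?_⟩
  obtain ⟨F, hF, hFA, hFab⟩ := exists_isPartialIso_of_sameType hab
  have hfin : (infClosure (Set.range fun i => (a i, b i))).Finite :=
    (Set.finite_range _).infClosure
  -- Only the finite part of `F` generated by the pairs `(a i, b i)` enters the amalgam.
  have hE := hdet.isPartialIso_amalgam hUt hNt hinf hle infClosed_infClosure hF hFA
    (infClosed_infClosure (s := Set.range fun i => (a i, b i)))
    (infClosure_min (by rintro _ ⟨i, rfl⟩; exact hFab i) hF.infClosed)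
  rw [hreal, hreal]
  refine hE.realize_iff hNt hNt φ (Amalgam.finite hCfin hfin) ?_ fun i => i.elim0
  rintro (i | i)
  · exact .left (subset_infClosure ⟨i, rfl⟩)
  · exact .right (subset_infClosure ⟨i, rfl⟩)
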